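/- A partition with at most $d$ parts is written as a $d$-tuple of integers $\alpha_1\ge\dots\ge\alpha_d\ge 0$; sums and differences of $d$-tuples are taken entrywise, containment $\beta\subseteq\alpha$ means $\beta_i\le\alpha_i$ for all $i$, and $\beta^{\leftarrow}=(\beta_d,\dots,\beta_1)$. For $\ell\ge 0$ let $(\ell)^d=(\ell,\dots,\ell)$ be the rectangle with $d$ rows of length $\ell$. For partitions $\alpha,\beta,\gamma$ with at most $d$ parts, the Littlewood--Richardson number $c_{\beta\,\gamma}^{\alpha}$ is the number of semistandard skew tableaux of shape $\alpha/\beta$ and type $\gamma$ (that is, with $\gamma_i$ entries equal to $i$ for $1\le i\le d$, and no other entries) such that in every initial part of the word obtained by reading the rows from top to bottom, each from right to left, the value $i$ occurs at least as often as the value $i+1$, for $i=1,\dots,d-1$; it is $0$ if $\beta\not\subseteq\alpha$. For integer $d$-tuples that are not all partitions, $c_{\beta\,\gamma}^{\alpha}$ is $0$ by convention. **Proposition.** Let $\alpha,\beta,\gamma$ be partitions with at most $d$ parts, and let $\square_\beta=(k)^d$ and $\square^\gamma=(m)^d$, with integers $k,m\ge 0$, be rectangles such that $\square_\beta\supseteq\beta$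 and $\square^\gamma\subseteq\gamma$. Then $$c_{\alpha\,\beta}^{\gamma}=c_{(\square_\beta-\beta^{\leftarrow})\,(\gamma-\square^\gamma)}^{\alpha+\square_\beta-\square^\gamma}.$$ -/

import Mathlib

/-- A partition with at most `d` parts, written as a weakly decreasing `d`-tuple of nonnegative
integers (padded by zeros). -/
def IsPartition {d : ℕ} (K : Fin d → ℤ) : Prop :=
  Antitone K ∧ ∀ i, 0 ≤ K i

/-- The rectangle `(ℓ)^d`: `d` rows of length `ℓ`. -/
def rect (d ℓ : ℕ) : Fin d → ℤ := fun _ => (ℓ : ℤ)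

/-- The reversed tuple `(k_d, …, k_1)`. -/
def revTuple {d : ℕ} (K : Fin d → ℤ) : Fin d → ℤ := fun i => K (Fin.rev i)

/-- The box in row `i` and column `j` (columns are numbered from `1`) lies in the skew diagram
`outer / inner`. -/
def InSkew {d : ℕ} (outer inner : Fin d → ℤ) (i : Fin d) (j : ℤ) : Prop :=
  inner i < j ∧ j ≤ outer i

/-- Semistandard fillings of `outer / inner` with entries in `{1, …, d}`: weakly increasing along
rows, strictly increasing down columns. Outside the diagram, the entry is `0` by convention, so
that distinct `T` are distinct tableaux. -/
structure IsSkewSSYT {d : ℕ} (outer inner : Fin d → ℤ) (T : Fin d → ℤ → ℕ) : Prop where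
  zeros : ∀ i j, ¬ InSkew outer inner i j → T i j = 0
  entries : ∀ i j, InSkew outer inner i j → 1 ≤ T i j ∧ T i j ≤ d
  row_weak : ∀ i j j', InSkew outer inner i j → InSkew outer inner i j' →
    j ≤ j' → T i j ≤ T i j'
  col_strict : ∀ i i' j, InSkew outer inner i j → InSkew outer inner i' j →
    i < i' → T i j < T i' j

/-- The word of a filling: the rows from top to bottom, each one read from right to left
(columns `outer i`, `outer i - 1`, …, `inner i + 1`). -/
def readingWord {d : ℕ} (outer inner : Fin d → ℤ) (T : Fin d → ℤ → ℕ) : List ℕ :=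
  (List.finRange d).flatMap fun i =>
    (List.range (outer i - inner i).toNat).map fun s => T i (outer i - (s : ℤ))

/-- In every initial part of the word `w`, the letter `i` occurs at least as often as `i + 1`,
for all `i = 1, …, d - 1`. -/
def IsLatticeWord (d : ℕ) (w : List ℕ) : Prop :=
  ∀ v : List ℕ, v <+: w → ∀ i : ℕ, 1 ≤ i → i + 1 ≤ d → v.count (i + 1) ≤ v.count i

/-- `T` is a Littlewood–Richardson skew tableau of shape `outer / inner` and type `type`: the
letter `i` occurs `type_i` times (`Fin d` numbers the parts from `0`). -/
structure IsLRTableau {d : ℕ} (outer inner type : Fin d → ℤ) (T : Fin d → ℤ → ℕ) : Prop where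
  ssyt : IsSkewSSYT outer inner T
  content : ∀ i : Fin d, ((readingWord outer inner T).count (i.val + 1) : ℤ) = type i
  lattice : IsLatticeWord d (readingWord outer inner T)

open Classical in
/-- The Littlewood–Richardson number `c_{β γ}^{α}`: the number of Littlewood–Richardson skew
tableaux of shape `α / β` and type `γ`. There are none unless `α`, `β`, `γ` are partitions and the
diagram of `β` is contained in that of `α`. -/
noncomputable def lrNumber {d : ℕ} (β γ α : Fin d → ℤ) : ℕ :=
  if IsPartition α ∧ IsPartition β ∧ IsPartition γ ∧ β ≤ α then
    Nat.card {T : Fin d → ℤ → ℕ // IsLRTableau α β γ T}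
  else 0

/-- There are finitely many tableaux of a given shape and type, so the cardinality in `lrNumber`
is an honest count. -/
theorem finite_lrTableaux {d : ℕ} (outer inner type : Fin d → ℤ) :
    Finite {T : Fin d → ℤ → ℕ // IsLRTableau outer inner type T} := by
  let F : {T : Fin d → ℤ → ℕ // IsLRTableau outer inner type T} →
      (∀ i : Fin d, Set.Ioc (inner i) (outer i) → Fin (d + 1)) := fun T i j =>
    ⟨T.1 i j.1, Nat.lt_succ_of_le (T.2.ssyt.entries i j.1 j.2).2⟩
  have hF : Function.Injective F := by
    intro T T' h
    apply Subtype.ext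
    funext i j
    by_cases hj : InSkew outer inner i j
    · have h1 := congrFun (congrFun h i) ⟨j, hj⟩
      exact congrArg Fin.val h1
    · rw [T.2.ssyt.zeros i j hj, T'.2.ssyt.zeros i j hj]
  have : ∀ i : Fin d, Finite (Set.Ioc (inner i) (outer i)) := fun i =>
    (Set.finite_Ioc (inner i) (outer i)).to_subtype
  exact Finite.of_injective F hF

open Finset

/-!
Counting the letters `l + 1` in the first `i` rows of a Littlewood–Richardson tableau of shape
`α / β` and type `γ` gives a triangular array: the lattice condition says that its rows interlace,
so that it is a Gelfand–Tsetlin pattern with top row `γ`, and strictness of the columns becomes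
dominance with respect to `β`. The partial sums of its rows, added to those of `β`, form a hive with
boundary `β`, `γ`, `α`. Reflecting a hive so as to exchange the ends of its left side exchanges the
other two sides, permutes the three families of rhombus inequalities and reverses and negates the
differences along the left side; adding the linear function `k i - m j` preserves all rhombus
inequalities and restores nonnegativity. Applied to the hives of `c_{β α}^γ`, this gives exactly the
hives of the number on the right-hand side.

It remains to exchange `α` and `β`. Following Stembridge, toggles of Bender–Knuth type on the part
of a pattern beyond its first failure of dominance cancel all non-dominant terms of the product of
an alternant and a Schur polynomial. Hence Littlewood–Richardson patterns are counted by
coefficients of `a_{α + ρ} s_β = a_ρ s_α s_β`, which is symmetric in `α` and `β`.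
-/

/-! ### Gelfand–Tsetlin patterns -/

/-- The row `y` interlaces the longer row `p`: `p₀ ≥ y₀ ≥ p₁ ≥ y₁ ≥ …`, as two consecutive rows of a
Gelfand–Tsetlin pattern do. -/
def Interlaces (y p : ℕ → ℤ) : Prop := ∀ j, y j ≤ p j ∧ p (j + 1) ≤ y j

/-- Gelfand–Tsetlin patterns with top row `β`. Row `i` holds the shape of the letters `1, …, i` of a
semistandard tableau; rows are extended by `0` to the right, and constantly by `β` from row `d` on,
so that distinct `x` are distinct patterns. -/
structure IsGTPattern (d : ℕ) (β : ℕ → ℤ) (x : ℕ → ℕ → ℤ) : Prop where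
  zero : ∀ j, x 0 j = 0
  top : ∀ i, d ≤ i → ∀ j, x i j = β j
  interlaces : ∀ i, Interlaces (x i) (x (i + 1))

namespace IsGTPattern

variable {d : ℕ} {β : ℕ → ℤ} {x : ℕ → ℕ → ℤ}

theorem le_succ (h : IsGTPattern d β x) (i j : ℕ) : x i j ≤ x (i + 1) j := (h.interlaces i j).1

theorem succ_le (h : IsGTPattern d β x) (i j : ℕ) : x (i + 1) (j + 1) ≤ x i j :=
  (h.interlaces i j).2

theorem mono (h : IsGTPattern d β x) (j : ℕ) : Monotone fun i => x i j :=
  monotone_nat_of_le_succ fun i => h.le_succ i j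

theorem nonneg (h : IsGTPattern d β x) (i j : ℕ) : 0 ≤ x i j :=
  (h.zero j).symm.trans_le (h.mono j (Nat.zero_le i))

theorem le_top (h : IsGTPattern d β x) (i j : ℕ) : x i j ≤ β j := by
  rw [← h.top (max i d) (le_max_right _ _) j]
  exact h.mono j (le_max_left _ _)

theorem eq_zero_of_le (h : IsGTPattern d β x) {i j : ℕ} (hij : i ≤ j) : x i j = 0 := by
  induction i generalizing j with
  | zero => exact h.zero j
  | succ i ih =>
    obtain ⟨j, rfl⟩ := Nat.exists_eq_add_of_le' (Nat.one_le_of_lt hij)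
    exact le_antisymm ((h.succ_le i j).trans_eq (ih (by omega))) (h.nonneg _ _)

theorem eq_zero_of_depth_le (h : IsGTPattern d β x) (i : ℕ) {j : ℕ} (hj : d ≤ j) : x i j = 0 := by
  refine le_antisymm ((h.le_top i j).trans_eq ?_) (h.nonneg i j)
  rw [← h.top d le_rfl, h.eq_zero_of_le hj]

end IsGTPattern

/-- The sum of the first `d` entries of row `i`. -/
def rowSum (d : ℕ) (x : ℕ → ℕ → ℤ) (i : ℕ) : ℤ := ∑ j ∈ range d, x i j

/-- The weight of a Gelfand–Tsetlin pattern, that is, the content of the corresponding tableau: the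
differences of consecutive row sums. -/
def gtWeight (d : ℕ) (x : ℕ → ℕ → ℤ) : Fin d → ℤ := fun i => rowSum d x (i + 1) - rowSum d x i

theorem IsGTPattern.sum_range_eq_rowSum {d : ℕ} {β : ℕ → ℤ} {x : ℕ → ℕ → ℤ}
    (h : IsGTPattern d β x) {i n : ℕ} (hn : min i d ≤ n) :
    ∑ j ∈ range n, x i j = rowSum d x i := by
  have hzero : ∀ j, min i d ≤ j → x i j = 0 := fun j hj =>
    (min_le_iff.1 hj).elim h.eq_zero_of_le (h.eq_zero_of_depth_le i)
  rw [rowSum, eventually_constant_sum hzero hn, eventually_constant_sum hzero (min_le_right i d)]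

/-! ### Bender–Knuth toggles -/

/-- The largest value that a toggle at column `k` allows for entry `k` of a row `y` between the
longer row `p` and the shorter row `q`. The offset `c` prescribes the sum of the toggled row. -/
def toggleCap (c : ℤ) (k : ℕ) (p y q : ℕ → ℤ) : ℤ :=
  p k + ∑ j ∈ range k, (p j - 2 * y j + q j) - c

/-- The largest value that a toggle at column `k` lets entry `j ≥ k` of a row take: the cap at
column `k`, and the bound `min (p j) (q (j - 1))` due to interlacing to the right of it. -/
def toggleBound (c : ℤ) (k : ℕ) (p y q : ℕ → ℤ) (j : ℕ) : ℤ :=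
  if j = k then toggleCap c k p y q else min (p j) (q (j - 1))

/-- The Bender–Knuth toggle of the row `y` between the rows `p` and `q`, restricted to the columns
from `k` on: each entry is reflected in the interval of its possible values. -/
def toggleRow (c : ℤ) (k : ℕ) (p y q : ℕ → ℤ) (j : ℕ) : ℤ :=
  if j < k then y j else toggleBound c k p y q j + max (p (j + 1)) (q j) - y j

/-- The conditions under which toggling at column `k` with offset `c` preserves interlacing. -/
structure CanToggle (c : ℤ) (k : ℕ) (p y q : ℕ → ℤ) : Prop where
  le_cap : y k ≤ toggleCap c k p y q
  cap_le : toggleCap c k p y q ≤ p k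
  cap_succ_le : ∀ j, j + 1 = k → toggleCap c k p y q ≤ q j

theorem toggleCap_succ (c : ℤ) (k : ℕ) (p y q : ℕ → ℤ) :
    toggleCap c (k + 1) p y q = toggleCap c k p y q + p (k + 1) - 2 * y k + q k := by
  rw [toggleCap, toggleCap, sum_range_succ]
  ring

theorem toggleCap_congr (c : ℤ) {k : ℕ} (p q : ℕ → ℤ) {y y' : ℕ → ℤ} (h : ∀ j < k, y j = y' j) :
    toggleCap c k p y q = toggleCap c k p y' q := by
  rw [toggleCap, toggleCap, sum_congr rfl fun j hj => by rw [h j (mem_range.1 hj)]]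

theorem toggleRow_of_lt {c : ℤ} {k j : ℕ} (p y q : ℕ → ℤ) (hj : j < k) :
    toggleRow c k p y q j = y j := if_pos hj

theorem toggleRow_of_le {c : ℤ} {k j : ℕ} (p y q : ℕ → ℤ) (hj : k ≤ j) :
    toggleRow c k p y q j = toggleBound c k p y q j + max (p (j + 1)) (q j) - y j :=
  if_neg hj.not_gt

theorem toggleCap_toggleRow (c : ℤ) (k : ℕ) (p y q : ℕ → ℤ) :
    toggleCap c k p (toggleRow c k p y q) q = toggleCap c k p y q :=
  toggleCap_congr c p q fun _ hj => toggleRow_of_lt p y q hj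

theorem toggleRow_toggleRow (c : ℤ) (k : ℕ) (p y q : ℕ → ℤ) :
    toggleRow c k p (toggleRow c k p y q) q = y := by
  funext j
  rcases lt_or_ge j k with hj | hj
  · rw [toggleRow_of_lt _ _ _ hj, toggleRow_of_lt _ _ _ hj]
  · rw [toggleRow_of_le _ _ _ hj, toggleRow_of_le _ _ _ hj, toggleBound, toggleCap_toggleRow,
      ← toggleBound]
    ring

theorem canToggle_zero {p y : ℕ → ℤ} (h : y 0 ≤ p 0) (q : ℕ → ℤ) : CanToggle 0 0 p y q where
  le_cap := by simpa [toggleCap] using h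
  cap_le := by simp [toggleCap]
  cap_succ_le j hj := absurd hj j.succ_ne_zero

namespace CanToggle

variable {c : ℤ} {k : ℕ} {p y q : ℕ → ℤ}

theorem le_toggleBound (ht : CanToggle c k p y q) (hyp : Interlaces y p) (hqy : Interlaces q y)
    {j : ℕ} (hj : k ≤ j) : y j ≤ toggleBound c k p y q j := by
  rcases hj.eq_or_lt with rfl | hlt
  · simpa only [toggleBound, if_true] using ht.le_cap
  · obtain ⟨j, rfl⟩ := Nat.exists_eq_add_of_le' (Nat.one_le_of_lt hlt)
    rw [toggleBound, if_neg hlt.ne']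
    exact le_min (hyp _).1 (hqy j).2

theorem toggleBound_le (ht : CanToggle c k p y q) (j : ℕ) : toggleBound c k p y q j ≤ p j := by
  rw [toggleBound]
  split_ifs with hj
  exacts [hj ▸ ht.cap_le, min_le_left _ _]

theorem toggleBound_succ_le (ht : CanToggle c k p y q) (j : ℕ) :
    toggleBound c k p y q (j + 1) ≤ q j := by
  rw [toggleBound]
  split_ifs with hj
  exacts [ht.cap_succ_le j hj, min_le_right _ _]

theorem toggleRow_le_toggleBound (hyp : Interlaces y p) (hqy : Interlaces q y) {j : ℕ}
    (hj : k ≤ j) : toggleRow c k p y q j ≤ toggleBound c k p y q j := by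
  have := max_le (hyp j).2 (hqy j).1
  rw [toggleRow_of_le _ _ _ hj]
  linarith

theorem max_le_toggleRow (ht : CanToggle c k p y q) (hyp : Interlaces y p) (hqy : Interlaces q y)
    (j : ℕ) : max (p (j + 1)) (q j) ≤ toggleRow c k p y q j := by
  rcases lt_or_ge j k with hj | hj
  · rw [toggleRow_of_lt _ _ _ hj]
    exact max_le (hyp j).2 (hqy j).1
  · have := ht.le_toggleBound hyp hqy hj
    rw [toggleRow_of_le _ _ _ hj]
    linarith

theorem interlaces_toggleRow_left (ht : CanToggle c k p y q) (hyp : Interlaces y p)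
    (hqy : Interlaces q y) : Interlaces (toggleRow c k p y q) p := by
  refine fun j => ⟨?_, (le_max_left _ _).trans (ht.max_le_toggleRow hyp hqy j)⟩
  rcases lt_or_ge j k with hj | hj
  · exact (toggleRow_of_lt _ _ _ hj).trans_le (hyp j).1
  · exact (toggleRow_le_toggleBound hyp hqy hj).trans (ht.toggleBound_le j)

theorem interlaces_toggleRow_right (ht : CanToggle c k p y q) (hyp : Interlaces y p)
    (hqy : Interlaces q y) : Interlaces q (toggleRow c k p y q) := by
  refine fun j => ⟨(le_max_right _ _).trans (ht.max_le_toggleRow hyp hqy j), ?_⟩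
  rcases lt_or_ge (j + 1) k with hj | hj
  · exact (toggleRow_of_lt _ _ _ hj).trans_le (hqy j).2
  · exact (toggleRow_le_toggleBound hyp hqy hj).trans (ht.toggleBound_succ_le j)

protected theorem toggleRow (ht : CanToggle c k p y q) (hyp : Interlaces y p)
    (hqy : Interlaces q y) : CanToggle c k p (toggleRow c k p y q) q := by
  refine ⟨?_, ?_, ?_⟩ <;> rw [toggleCap_toggleRow]
  · simpa only [toggleBound, if_true] using toggleRow_le_toggleBound (c := c) hyp hqy (le_refl k)
  · exact ht.cap_le
  · exact ht.cap_succ_le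

end CanToggle

theorem sum_toggleRow_add (c : ℤ) {k n : ℕ} (p y q : ℕ → ℤ) (hn : k ≤ n) :
    ∑ j ∈ range (n + 1), (toggleRow c k p y q j + y j) =
      ∑ j ∈ range (n + 1), (p j + q j) - c + max (p (n + 1)) (q n) - q n := by
  induction n, hn using Nat.le_induction with
  | base =>
    have hlow : ∀ j ∈ range k, toggleRow c k p y q j + y j = 2 * y j := fun j hj => by
      rw [toggleRow_of_lt _ _ _ (mem_range.1 hj), two_mul]
    rw [sum_range_succ, sum_congr rfl hlow, toggleRow_of_le _ _ _ le_rfl, toggleBound, if_pos rfl,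
      toggleCap, sum_range_succ]
    simp only [sum_add_distrib, sum_sub_distrib]
    ring
  | succ n hn ih =>
    have hminmax := min_add_max (p (n + 1)) (q n)
    rw [sum_range_succ, ih, sum_range_succ _ (n + 1), toggleRow_of_le _ _ _ (by omega), toggleBound,
      if_neg (by omega), Nat.add_sub_cancel]
    linarith

/-- The toggle of row `i + 1` of a pattern at column `k` with offset `c`. -/
def toggle (c : ℤ) (i k : ℕ) (x : ℕ → ℕ → ℤ) : ℕ → ℕ → ℤ :=
  Function.update x (i + 1) (toggleRow c k (x (i + 2)) (x (i + 1)) (x i))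

theorem toggle_self (c : ℤ) (i k : ℕ) (x : ℕ → ℕ → ℤ) :
    toggle c i k x (i + 1) = toggleRow c k (x (i + 2)) (x (i + 1)) (x i) :=
  Function.update_self ..

theorem toggle_of_ne (c : ℤ) {i r : ℕ} (k : ℕ) (x : ℕ → ℕ → ℤ) (hr : r ≠ i + 1) :
    toggle c i k x r = x r :=
  Function.update_of_ne hr ..

theorem toggle_of_lt (c : ℤ) {k j : ℕ} (i r : ℕ) (x : ℕ → ℕ → ℤ) (hj : j < k) :
    toggle c i k x r j = x r j := by
  by_cases hr : r = i + 1
  · rw [hr, toggle_self, toggleRow_of_lt _ _ _ hj]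
  · rw [toggle_of_ne c k x hr]

theorem toggle_toggle (c : ℤ) (i k : ℕ) (x : ℕ → ℕ → ℤ) : toggle c i k (toggle c i k x) = x := by
  rw [toggle, toggle_self, toggle_of_ne c k x (by omega), toggle_of_ne c k x (by omega),
    toggleRow_toggleRow, toggle, Function.update_idem, Function.update_eq_self]

section Toggle

variable {d : ℕ} {β : ℕ → ℤ} {x : ℕ → ℕ → ℤ} {c : ℤ} {i k : ℕ}

protected theorem IsGTPattern.toggle (h : IsGTPattern d β x) (hi : i + 1 < d)
    (ht : CanToggle c k (x (i + 2)) (x (i + 1)) (x i)) : IsGTPattern d β (toggle c i k x) where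
  zero j := by rw [toggle_of_ne c k x (by omega), h.zero]
  top r hr j := by rw [toggle_of_ne c k x (by omega), h.top r hr]
  interlaces r := by
    by_cases hr : r = i + 1
    · subst hr
      rw [toggle_self, toggle_of_ne c k x (by omega)]
      exact ht.interlaces_toggleRow_left (h.interlaces _) (h.interlaces _)
    · rw [toggle_of_ne c k x hr]
      by_cases hr' : r = i
      · subst hr'
        rw [toggle_self]
        exact ht.interlaces_toggleRow_right (h.interlaces _) (h.interlaces _)
      · rw [toggle_of_ne c k x (by omega)]
        exact h.interlaces r

theorem IsGTPattern.rowSum_toggle (h : IsGTPattern d β x) (hi : i + 1 < d)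
    (ht : CanToggle c k (x (i + 2)) (x (i + 1)) (x i)) :
    rowSum d (toggle c i k x) (i + 1) =
      rowSum d x (i + 2) + rowSum d x i - rowSum d x (i + 1) - c := by
  have hd : d ≤ max k d + 1 := (le_max_right k d).trans (Nat.le_succ _)
  have hsum := sum_toggleRow_add c (x (i + 2)) (x (i + 1)) (x i) (le_max_left k d)
  have hrow : ∀ r, ∑ j ∈ range (max k d + 1), x r j = rowSum d x r := fun r =>
    h.sum_range_eq_rowSum (min_le_of_right_le hd)
  rw [← toggle_self, h.eq_zero_of_depth_le _ hd, h.eq_zero_of_depth_le _ (le_max_right k d),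
    sum_add_distrib, sum_add_distrib, hrow, hrow, hrow,
    (h.toggle hi ht).sum_range_eq_rowSum (min_le_of_right_le hd), max_self] at hsum
  linarith

theorem IsGTPattern.add_gtWeight_toggle (h : IsGTPattern d β x) (hi : i + 1 < d) {v : Fin d → ℤ}
    (hc : c = v ⟨i, Nat.lt_of_succ_lt hi⟩ - v ⟨i + 1, hi⟩)
    (ht : CanToggle c k (x (i + 2)) (x (i + 1)) (x i)) :
    v + gtWeight d (toggle c i k x) =
      (v + gtWeight d x) ∘ Equiv.swap ⟨i, Nat.lt_of_succ_lt hi⟩ ⟨i + 1, hi⟩ := by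
  have hsum := h.rowSum_toggle hi ht
  have hrow : ∀ r ≠ i + 1, rowSum d (toggle c i k x) r = rowSum d x r := fun r hr => by
    rw [rowSum, toggle_of_ne c k x hr, rowSum]
  funext r
  simp only [Pi.add_apply, Function.comp_apply, gtWeight]
  by_cases h0 : r = ⟨i, Nat.lt_of_succ_lt hi⟩
  · rw [h0, Equiv.swap_apply_left, hsum, hrow i (by omega), hc]
    ring
  by_cases h1 : r = ⟨i + 1, hi⟩
  · rw [h1, Equiv.swap_apply_right, hsum, hrow (i + 1 + 1) (by omega), hc]
    ring
  · rw [Equiv.swap_apply_of_ne_of_ne h0 h1, hrow _ fun e => h0 (Fin.ext (Nat.succ_injective e)),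
      hrow _ fun e => h1 (Fin.ext e)]

end Toggle

/-! ### Dominance -/

/-- Let the tableau of the pattern `x` be read row by row, each one from right to left, starting
with the content `α`. After the letters `i + 2` of row `k` (rows are numbered from `0`), there are
at most as many letters `i + 2` as letters `i + 1`. -/
def DominantAt (α : ℕ → ℤ) (x : ℕ → ℕ → ℤ) (i k : ℕ) : Prop :=
  α (i + 1) + ∑ j ∈ range (k + 1), (x (i + 2) j - x (i + 1) j) ≤
    α i + ∑ j ∈ range k, (x (i + 1) j - x i j)

/-- `α`-dominance of a pattern: the contents of the initial parts of the reading word of the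
corresponding tableau remain weakly decreasing when added to `α`. -/
def RowDominant (d : ℕ) (α : ℕ → ℤ) (x : ℕ → ℕ → ℤ) : Prop :=
  ∀ i, i + 1 < d → ∀ k, DominantAt α x i k

/-- The failure of `α`-dominance at which the sign-reversing involution toggles a pattern: the least
possible `k`, and the greatest `i` for this `k`. -/
structure IsFirstFailure (d : ℕ) (α : ℕ → ℤ) (x : ℕ → ℕ → ℤ) (i k : ℕ) : Prop where
  lt : i + 1 < d
  not_dominantAt : ¬ DominantAt α x i k
  dominantAt_of_lt : ∀ i' k', i' + 1 < d → k' < k → DominantAt α x i' k'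
  dominantAt_of_gt : ∀ i', i < i' → i' + 1 < d → DominantAt α x i' k

section Dominance

variable {d : ℕ} {α β : ℕ → ℤ} {x x' : ℕ → ℕ → ℤ} {i k : ℕ}

theorem dominantAt_iff_toggleCap_lt : DominantAt α x i k ↔
    toggleCap (α i - α (i + 1) + 1) k (x (i + 2)) (x (i + 1)) (x i) < x (i + 1) k := by
  simp only [DominantAt, toggleCap, sum_range_succ, sum_add_distrib, sum_sub_distrib, ← mul_sum]
  constructor <;> intro h <;> linarith

theorem DominantAt.congr (h : DominantAt α x i k) (h2 : ∀ j ≤ k, x' (i + 2) j = x (i + 2) j)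
    (h1 : ∀ j ≤ k, x' (i + 1) j = x (i + 1) j) (h0 : ∀ j < k, x' i j = x i j) :
    DominantAt α x' i k := by
  have hupper : ∀ j ∈ range (k + 1), x' (i + 2) j - x' (i + 1) j = x (i + 2) j - x (i + 1) j :=
    fun j hj => by rw [h2 j (mem_range_succ_iff.1 hj), h1 j (mem_range_succ_iff.1 hj)]
  have hlower : ∀ j ∈ range k, x' (i + 1) j - x' i j = x (i + 1) j - x i j :=
    fun j hj => by rw [h1 j (mem_range.1 hj).le, h0 j (mem_range.1 hj)]
  rwa [DominantAt, sum_congr rfl hupper, sum_congr rfl hlower]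

theorem exists_isFirstFailure (h : ¬ RowDominant d α x) : ∃ i k, IsFirstFailure d α x i k := by
  classical
  have hfail : ∃ k i, i + 1 < d ∧ ¬ DominantAt α x i k := by
    simp only [RowDominant, not_forall] at h
    obtain ⟨i, hi, k, hk⟩ := h
    exact ⟨k, i, hi, hk⟩
  obtain ⟨i, hi, hmax⟩ := Finset.exists_max_image
    ((range d).filter fun i => i + 1 < d ∧ ¬ DominantAt α x i (Nat.find hfail)) id
    (by
      obtain ⟨i, hi⟩ := Nat.find_spec hfail
      exact ⟨i, mem_filter.2 ⟨mem_range.2 (by omega), hi⟩⟩)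
  have hfails := (mem_filter.1 hi).2
  refine ⟨i, Nat.find hfail, hfails.1, hfails.2, fun i' k' hi' hk' => ?_, fun i' hlt hi' => ?_⟩
  · by_contra hnot
    exact Nat.find_min hfail hk' ⟨i', hi', hnot⟩
  · by_contra hnot
    exact hlt.not_ge (hmax i' (mem_filter.2 ⟨mem_range.2 (by omega), hi', hnot⟩))

namespace IsFirstFailure

theorem unique {i' k' : ℕ} (hf : IsFirstFailure d α x i k) (hf' : IsFirstFailure d α x i' k') :
    i = i' ∧ k = k' := by
  obtain rfl : k = k' := le_antisymm
    (not_lt.1 fun hlt => hf'.not_dominantAt (hf.dominantAt_of_lt i' k' hf'.lt hlt))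
    (not_lt.1 fun hlt => hf.not_dominantAt (hf'.dominantAt_of_lt i k hf.lt hlt))
  exact ⟨le_antisymm
    (not_lt.1 fun hlt => hf.not_dominantAt (hf'.dominantAt_of_gt i hlt hf.lt))
    (not_lt.1 fun hlt => hf'.not_dominantAt (hf.dominantAt_of_gt i' hlt hf'.lt)), rfl⟩

theorem canToggle (hf : IsFirstFailure d α x i k) (hα : Antitone α) (h : IsGTPattern d β x) :
    CanToggle (α i - α (i + 1) + 1) k (x (i + 2)) (x (i + 1)) (x i) := by
  have hle := not_lt.1 (mt dominantAt_iff_toggleCap_lt.2 hf.not_dominantAt)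
  rcases k with _ | k
  · refine ⟨hle, ?_, fun j hj => absurd hj j.succ_ne_zero⟩
    have := hα i.le_succ
    simp only [toggleCap, range_zero, sum_empty]
    linarith
  · have hcap := toggleCap_succ (α i - α (i + 1) + 1) k (x (i + 2)) (x (i + 1)) (x i)
    have hdom := dominantAt_iff_toggleCap_lt.1 (hf.dominantAt_of_lt i k hf.lt k.lt_succ_self)
    have hqy := h.le_succ i k
    have hpy : x (i + 2) (k + 1) ≤ x (i + 1) k := h.succ_le (i + 1) k
    refine ⟨hle, by linarith, fun j hj => ?_⟩
    obtain rfl := Nat.succ_injective hj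
    linarith

/-- This is why `i` is taken to be greatest: toggling changes entry `k` of row `i + 1`, on which
`DominantAt α x i' k` depends for `i' = i - 1`, but not for `i' > i`. -/
protected theorem toggle (hf : IsFirstFailure d α x i k) (hα : Antitone α)
    (h : IsGTPattern d β x) :
    IsFirstFailure d α (toggle (α i - α (i + 1) + 1) i k x) i k where
  lt := hf.lt
  not_dominantAt := by
    rw [dominantAt_iff_toggleCap_lt, toggle_self, toggle_of_ne _ k x (by omega),
      toggle_of_ne _ k x (by omega), not_lt]
    exact ((hf.canToggle hα h).toggleRow (h.interlaces (i + 1)) (h.interlaces i)).le_cap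
  dominantAt_of_lt i' k' hi' hk' := (hf.dominantAt_of_lt i' k' hi' hk').congr
    (fun _ hj => toggle_of_lt _ _ _ x (hj.trans_lt hk'))
    (fun _ hj => toggle_of_lt _ _ _ x (hj.trans_lt hk'))
    (fun _ hj => toggle_of_lt _ _ _ x (hj.trans hk'))
  dominantAt_of_gt i' hlt hi' := (hf.dominantAt_of_gt i' hlt hi').congr
    (fun _ _ => by rw [toggle_of_ne _ k x (by omega)])
    (fun _ _ => by rw [toggle_of_ne _ k x (by omega)])
    (fun _ hj => toggle_of_lt _ _ _ x hj)

end IsFirstFailure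

end Dominance

/-! ### Alternants and Schur polynomials -/

theorem finite_gtPatterns (d : ℕ) (β : ℕ → ℤ) : {x | IsGTPattern d β x}.Finite := by
  let restriction : (ℕ → ℕ → ℤ) → (Fin d → Fin d → ℤ) := fun x i j => x i j
  refine Set.Finite.of_finite_image (f := restriction) ?_ ?_
  · refine (Set.Finite.pi' fun _ : Fin d => Set.Finite.pi' fun j : Fin d =>
      Set.finite_Icc (0 : ℤ) (β j)).subset ?_
    rintro _ ⟨x, hx, rfl⟩ i j
    exact ⟨hx.nonneg _ _, hx.le_top _ _⟩
  · intro x (hx : IsGTPattern d β x) y (hy : IsGTPattern d β y) hxy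
    funext i j
    rcases lt_or_ge i d with hi | hi
    · rcases lt_or_ge j d with hj | hj
      · exact congrFun (congrFun hxy ⟨i, hi⟩) ⟨j, hj⟩
      · rw [hx.eq_zero_of_depth_le i hj, hy.eq_zero_of_depth_le i hj]
    · rw [hx.top i hi, hy.top i hi]

/-- The finite set of Gelfand–Tsetlin patterns with top row `β`. -/
noncomputable def gtPatterns (d : ℕ) (β : ℕ → ℤ) : Finset (ℕ → ℕ → ℤ) :=
  (finite_gtPatterns d β).toFinset

theorem mem_gtPatterns {d : ℕ} {β : ℕ → ℤ} {x : ℕ → ℕ → ℤ} :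
    x ∈ gtPatterns d β ↔ IsGTPattern d β x := by
  rw [gtPatterns, Set.Finite.mem_toFinset, Set.mem_ofPred_eq]

/-- The alternant with exponent `v`: the antisymmetrization of a Laurent monomial. -/
noncomputable def alternant {d : ℕ} (v : Fin d → ℤ) : AddMonoidAlgebra ℤ (Fin d → ℤ) :=
  ∑ σ : Equiv.Perm (Fin d), AddMonoidAlgebra.single (v ∘ σ) (Equiv.Perm.sign σ : ℤ)

/-- The Schur polynomial of `β` in `d` variables, as an element of the ring of Laurent
polynomials. -/
noncomputable def schurPoly (d : ℕ) (β : ℕ → ℤ) : AddMonoidAlgebra ℤ (Fin d → ℤ) :=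
  ∑ x ∈ gtPatterns d β, AddMonoidAlgebra.single (gtWeight d x) 1

/-- The tuple `v + ρ`, where the staircase is normalized to `ρ = (0, -1, …, -(d - 1))`. -/
def shifted (d : ℕ) (v : ℕ → ℤ) : Fin d → ℤ := fun i => v i - i

theorem alternant_comp_swap {d : ℕ} (v : Fin d → ℤ) {i j : Fin d} (hij : i ≠ j) :
    alternant (v ∘ Equiv.swap i j) = - alternant v := by
  rw [alternant, alternant, ← sum_neg_distrib]
  refine Fintype.sum_equiv (Equiv.mulLeft (Equiv.swap i j)) _ _ fun σ => ?_
  rw [Equiv.coe_mulLeft, Equiv.Perm.sign_mul, Equiv.Perm.sign_swap hij,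
    ← AddMonoidAlgebra.single_neg, neg_one_mul, Units.val_neg, neg_neg, Equiv.Perm.coe_mul,
    Function.comp_assoc]

theorem sum_gtWeight_comp_swap {M : Type*} [AddCommMonoid M] {d : ℕ} (β : ℕ → ℤ)
    (F : (Fin d → ℤ) → M) {i : ℕ} (hi : i + 1 < d) :
    ∑ x ∈ gtPatterns d β, F (gtWeight d x ∘ Equiv.swap ⟨i, Nat.lt_of_succ_lt hi⟩ ⟨i + 1, hi⟩) =
      ∑ x ∈ gtPatterns d β, F (gtWeight d x) := by
  have hcan : ∀ x ∈ gtPatterns d β, CanToggle 0 0 (x (i + 2)) (x (i + 1)) (x i) := fun x hx =>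
    canToggle_zero ((mem_gtPatterns.1 hx).le_succ (i + 1) 0) _
  have hmem : ∀ x ∈ gtPatterns d β, toggle 0 i 0 x ∈ gtPatterns d β := fun x hx =>
    mem_gtPatterns.2 ((mem_gtPatterns.1 hx).toggle hi (hcan x hx))
  refine sum_nbij' (toggle 0 i 0) (toggle 0 i 0) hmem hmem (fun x _ => toggle_toggle 0 i 0 x)
    (fun x _ => toggle_toggle 0 i 0 x) fun x hx => ?_
  have hweight := (mem_gtPatterns.1 hx).add_gtWeight_toggle hi (v := 0) (sub_self 0).symm
    (hcan x hx)
  rw [zero_add, zero_add] at hweight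
  rw [hweight]

theorem sum_gtWeight_comp {M : Type*} [AddCommMonoid M] {d : ℕ} (β : ℕ → ℤ)
    (F : (Fin d → ℤ) → M) (σ : Equiv.Perm (Fin d)) :
    ∑ x ∈ gtPatterns d β, F (gtWeight d x ∘ σ) = ∑ x ∈ gtPatterns d β, F (gtWeight d x) := by
  rcases d with _ | n
  · exact sum_congr rfl fun x _ => congrArg F (Subsingleton.elim _ _)
  · have hσ : σ ∈ Submonoid.closure
        (Set.range fun i : Fin n => Equiv.swap i.castSucc i.succ) := by
      rw [Equiv.Perm.mclosure_swap_castSucc_succ]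
      exact Submonoid.mem_top σ
    induction hσ using Submonoid.closure_induction generalizing F with
    | mem τ hτ =>
      obtain ⟨i, rfl⟩ := hτ
      exact sum_gtWeight_comp_swap β F (Nat.succ_lt_succ i.2)
    | one => rfl
    | mul σ τ _ _ hσ hτ =>
      rw [← hτ F]
      exact hσ fun w => F (w ∘ τ)

theorem alternant_mul_schurPoly {d : ℕ} (v : Fin d → ℤ) (β : ℕ → ℤ) :
    alternant v * schurPoly d β = ∑ x ∈ gtPatterns d β, alternant (v + gtWeight d x) := by
  simp only [alternant]
  rw [sum_comm, sum_mul]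
  refine sum_congr rfl fun σ _ => ?_
  rw [schurPoly, ← sum_gtWeight_comp β (fun w => AddMonoidAlgebra.single w (1 : ℤ)) σ, mul_sum]
  refine sum_congr rfl fun x _ => ?_
  rw [AddMonoidAlgebra.single_mul_single, mul_one]
  rfl

theorem IsFirstFailure.alternant_add_alternant_toggle {d : ℕ} {α β : ℕ → ℤ} {x : ℕ → ℕ → ℤ}
    {i k : ℕ} (hf : IsFirstFailure d α x i k) (hα : Antitone α) (h : IsGTPattern d β x) :
    alternant (shifted d α + gtWeight d x) +
      alternant (shifted d α + gtWeight d (toggle (α i - α (i + 1) + 1) i k x)) = 0 := by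
  have hoffset : α i - α (i + 1) + 1 =
      shifted d α ⟨i, Nat.lt_of_succ_lt hf.lt⟩ - shifted d α ⟨i + 1, hf.lt⟩ := by
    simp only [shifted]
    push_cast
    ring
  rw [h.add_gtWeight_toggle hf.lt hoffset (hf.canToggle hα h),
    alternant_comp_swap _ (Fin.ne_of_val_ne i.lt_succ_self.ne), add_neg_cancel]

theorem eq_zero_of_add_self_eq_zero {M : Type*} {p : AddMonoidAlgebra ℤ M} (h : p + p = 0) :
    p = 0 := by
  ext u
  have hu := congrArg (fun q => q.coeff u) h
  simp only [AddMonoidAlgebra.coeff_add, Finsupp.add_apply, AddMonoidAlgebra.coeff_zero,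
    Finsupp.zero_apply] at hu ⊢
  omega

open Classical in
theorem alternant_shifted_mul_schurPoly {d : ℕ} {α : ℕ → ℤ} (hα : Antitone α) (β : ℕ → ℤ) :
    alternant (shifted d α) * schurPoly d β =
      ∑ x ∈ gtPatterns d β with RowDominant d α x, alternant (shifted d α + gtWeight d x) := by
  rw [alternant_mul_schurPoly, ← sum_filter_add_sum_filter_not (gtPatterns d β) (RowDominant d α),
    add_eq_left]
  have hpattern : ∀ x ∈ (gtPatterns d β).filter fun x => ¬ RowDominant d α x,
      IsGTPattern d β x := fun x hx => mem_gtPatterns.1 (mem_filter.1 hx).1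
  choose! i k hfirst using fun x
    (hx : x ∈ (gtPatterns d β).filter fun x => ¬ RowDominant d α x) =>
    exists_isFirstFailure (mem_filter.1 hx).2
  have hcancel := fun x hx => (hfirst x hx).alternant_add_alternant_toggle hα (hpattern x hx)
  have hmem : ∀ x ∈ (gtPatterns d β).filter fun x => ¬ RowDominant d α x,
      toggle (α (i x) - α (i x + 1) + 1) (i x) (k x) x ∈
        (gtPatterns d β).filter fun x => ¬ RowDominant d α x := fun x hx =>
    have hf := hfirst x hx
    mem_filter.2 ⟨mem_gtPatterns.2 ((hpattern x hx).toggle hf.lt (hf.canToggle hα (hpattern x hx))),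
      fun hdom => (hf.toggle hα (hpattern x hx)).not_dominantAt (hdom _ hf.lt _)⟩
  refine sum_involution (fun x _ => toggle (α (i x) - α (i x + 1) + 1) (i x) (k x) x) hcancel
    (fun x hx hne hfix => ?_) hmem fun x hx => ?_
  · have := hcancel x hx
    rw [hfix] at this
    exact hne (eq_zero_of_add_self_eq_zero this)
  · obtain ⟨hi, hk⟩ :=
      (hfirst _ (hmem x hx)).unique ((hfirst x hx).toggle hα (hpattern x hx))
    simp only [hi, hk, toggle_toggle]

theorem perm_eq_one_of_comp_strictAnti {d : ℕ} {v : Fin d → ℤ} {σ : Equiv.Perm (Fin d)}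
    (hv : StrictAnti v) (hσ : StrictAnti (v ∘ σ)) : σ = 1 := by
  have hmono : StrictMono σ := fun _ _ hij => hv.lt_iff_gt.1 (hσ hij)
  refine DFunLike.coe_injective ((hmono.range_inj strictMono_id).1 ?_)
  rw [σ.surjective.range_eq, Set.range_id]

theorem coeff_alternant {d : ℕ} {u v : Fin d → ℤ} (hu : StrictAnti u) (hv : StrictAnti v) :
    (alternant v).coeff u = if v = u then 1 else 0 := by
  rw [alternant, AddMonoidAlgebra.coeff_sum, Finsupp.finsetSum_apply,
    sum_eq_single_of_mem (1 : Equiv.Perm (Fin d)) (mem_univ _)]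
  · rw [AddMonoidAlgebra.coeff_single, Finsupp.single_apply, Equiv.Perm.coe_one,
      Function.comp_id, Equiv.Perm.sign_one, Units.val_one]
  · intro σ _ hne
    rw [AddMonoidAlgebra.coeff_single, Finsupp.single_apply, if_neg]
    rintro rfl
    exact hne (perm_eq_one_of_comp_strictAnti hv hu)

theorem strictAnti_shifted {d : ℕ} {v : ℕ → ℤ} (hv : Antitone fun i : Fin d => v i) :
    StrictAnti (shifted d v) := by
  intro i j hij
  have hle : v j ≤ v i := hv hij.le
  rw [shifted, shifted]
  omega

theorem strictAnti_shifted_add_gtWeight {d : ℕ} {α β : ℕ → ℤ} {x : ℕ → ℕ → ℤ}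
    (h : IsGTPattern d β x) (hx : RowDominant d α x) :
    StrictAnti (shifted d α + gtWeight d x) := by
  rcases d with _ | n
  · exact Subsingleton.strictAnti _
  refine Fin.strictAnti_iff_succ_lt.2 fun i => ?_
  have hdom := hx i (Nat.succ_lt_succ i.2) (n + 1)
  simp only [DominantAt, sum_sub_distrib] at hdom
  simp only [h.sum_range_eq_rowSum (min_le_of_right_le le_rfl),
    h.sum_range_eq_rowSum (min_le_of_right_le (Nat.le_succ (n + 1)))] at hdom
  simp only [Pi.add_apply, shifted, gtWeight, Fin.val_succ, Fin.val_castSucc]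
  push_cast
  linarith

/-- Littlewood–Richardson patterns: the `α`-dominant Gelfand–Tsetlin patterns with top row `β` and
weight `γ - α`. Their number is the coefficient of the Schur polynomial of `γ` in the product of
those of `α` and `β`. -/
structure IsLRPattern (d : ℕ) (α β γ : ℕ → ℤ) (x : ℕ → ℕ → ℤ) : Prop where
  pattern : IsGTPattern d β x
  dominant : RowDominant d α x
  weight : ∀ i : Fin d, α i + gtWeight d x i = γ i

theorem coeff_alternant_mul_schurPoly {d : ℕ} {α γ : ℕ → ℤ} (hα : Antitone α)
    (hγ : Antitone fun i : Fin d => γ i) (β : ℕ → ℤ) :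
    (alternant (shifted d α) * schurPoly d β).coeff (shifted d γ) =
      Nat.card {x // IsLRPattern d α β γ x} := by
  classical
  have hweight : ∀ x, shifted d α + gtWeight d x = shifted d γ ↔
      ∀ i : Fin d, α i + gtWeight d x i = γ i := fun x => by
    rw [funext_iff]
    simp only [Pi.add_apply, shifted, sub_add_eq_add_sub, sub_left_inj]
  have hmem : ∀ x, x ∈ ((gtPatterns d β).filter (RowDominant d α)).filter
      (fun x => shifted d α + gtWeight d x = shifted d γ) ↔ IsLRPattern d α β γ x := fun x => by
    rw [mem_filter, mem_filter, mem_gtPatterns, hweight]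
    exact ⟨fun h => ⟨h.1.1, h.1.2, h.2⟩, fun h => ⟨⟨h.pattern, h.dominant⟩, h.weight⟩⟩
  rw [alternant_shifted_mul_schurPoly hα, AddMonoidAlgebra.coeff_sum, Finsupp.finsetSum_apply,
    Nat.subtype_card _ hmem, card_filter, Nat.cast_sum]
  refine sum_congr rfl fun x hx => ?_
  obtain ⟨hpattern, hdom⟩ := mem_filter.1 hx
  rw [coeff_alternant (strictAnti_shifted hγ)
    (strictAnti_shifted_add_gtWeight (mem_gtPatterns.1 hpattern) hdom), Nat.cast_ite,
    Nat.cast_one, Nat.cast_zero]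

/-- The pattern of the tableau of shape `β` with all entries of row `i` equal to `i`. -/
def highestPattern (β : ℕ → ℤ) (i j : ℕ) : ℤ := if j < i then β j else 0

theorem highestPattern_succ_sub (β : ℕ → ℤ) (i j : ℕ) :
    highestPattern β (i + 1) j - highestPattern β i j = if j = i then β i else 0 := by
  rcases lt_trichotomy j i with h | rfl | h
  · rw [highestPattern, highestPattern, if_pos (by omega), if_pos h, if_neg h.ne, sub_self]
  · rw [highestPattern, highestPattern, if_pos (by omega), if_neg (lt_irrefl j), if_pos rfl,
      sub_zero]
  · rw [highestPattern, highestPattern, if_neg (by omega), if_neg (by omega), if_neg h.ne',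
      sub_self]

theorem isGTPattern_highestPattern {d : ℕ} {β : ℕ → ℤ} (hβ : Antitone β)
    (hβ0 : ∀ j, d ≤ j → β j = 0) : IsGTPattern d β (highestPattern β) where
  zero j := if_neg j.not_lt_zero
  top i hi j := by
    rw [highestPattern, ite_eq_left_iff]
    exact fun hj => (hβ0 j (by omega)).symm
  interlaces i j := by
    have hnonneg : 0 ≤ β j :=
      (hβ0 (max d j) (le_max_left d j)).symm.trans_le (hβ (le_max_right d j))
    have hsucc : β (j + 1) ≤ β j := hβ j.le_succ
    simp only [highestPattern]
    split_ifs <;> omega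

theorem rowDominant_highestPattern (d : ℕ) {β : ℕ → ℤ} (hβ : Antitone β) :
    RowDominant d 0 (highestPattern β) := by
  intro i _ k
  have hsucc : β (i + 1) ≤ β i := hβ i.le_succ
  simp only [DominantAt, Pi.zero_apply, zero_add, highestPattern_succ_sub, sum_ite_eq', mem_range,
    add_lt_add_iff_right]
  split_ifs <;> omega

theorem gtWeight_highestPattern {d : ℕ} (β : ℕ → ℤ) (i : Fin d) :
    gtWeight d (highestPattern β) i = β i := by
  simp only [gtWeight, rowSum, ← sum_sub_distrib, highestPattern_succ_sub, sum_ite_eq', mem_range,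
    i.2, if_true]

theorem IsGTPattern.succ_eq_of_rowDominant_zero {d : ℕ} {β : ℕ → ℤ} {x : ℕ → ℕ → ℤ}
    (h : IsGTPattern d β x) (hx : RowDominant d 0 x) {i j : ℕ} (hj : j < i) :
    x (i + 1) j = x i j := by
  have hsum : ∀ k i, k ≤ i → ∑ j ∈ range k, (x (i + 1) j - x i j) ≤ 0 := by
    intro k
    induction k with
    | zero => exact fun i _ => (sum_range_zero _).le
    | succ k ih =>
      intro i hi
      obtain ⟨i, rfl⟩ := Nat.exists_eq_add_of_le' (Nat.one_le_of_lt hi)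
      rcases lt_or_ge (i + 1) d with hid | hid
      · have hdom := hx i hid k
        simp only [DominantAt, Pi.zero_apply, zero_add] at hdom
        exact hdom.trans (ih i (by omega))
      · refine (sum_eq_zero fun j _ => ?_).le
        rw [h.top _ (by omega), h.top _ hid, sub_self]
  have hnonneg : ∀ l ∈ range i, 0 ≤ x (i + 1) l - x i l := fun l _ => sub_nonneg.2 (h.le_succ i l)
  have hzero := (sum_eq_zero_iff_of_nonneg hnonneg).1
    (le_antisymm (hsum i i le_rfl) (sum_nonneg hnonneg))
  exact sub_eq_zero.1 (hzero j (mem_range.2 hj))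

theorem IsGTPattern.eq_highestPattern {d : ℕ} {β : ℕ → ℤ} {x : ℕ → ℕ → ℤ}
    (h : IsGTPattern d β x) (hx : RowDominant d 0 x) : x = highestPattern β := by
  funext i j
  rw [highestPattern]
  split_ifs with hj
  · have hconst : ∀ n, i ≤ n → x n j = x i j := fun n hn => by
      induction n, hn using Nat.le_induction with
      | base => rfl
      | succ n hn ih => rw [h.succ_eq_of_rowDominant_zero hx (hj.trans_le hn), ih]
    rw [← hconst _ (le_max_left i d), h.top _ (le_max_right i d)]
  · exact h.eq_zero_of_le (not_lt.1 hj)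

theorem alternant_zero_mul_schurPoly {d : ℕ} {β : ℕ → ℤ} (hβ : Antitone β)
    (hβ0 : ∀ j, d ≤ j → β j = 0) :
    alternant (shifted d 0) * schurPoly d β = alternant (shifted d β) := by
  classical
  rw [alternant_shifted_mul_schurPoly (α := 0) antitone_const,
    sum_eq_single_of_mem (highestPattern β)]
  · congr 1
    funext i
    simp only [Pi.add_apply, gtWeight_highestPattern, shifted, Pi.zero_apply]
    ring
  · exact mem_filter.2 ⟨mem_gtPatterns.2 (isGTPattern_highestPattern hβ hβ0),
      rowDominant_highestPattern d hβ⟩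
  · intro x hx hne
    obtain ⟨hx, hx'⟩ := mem_filter.1 hx
    exact absurd ((mem_gtPatterns.1 hx).eq_highestPattern hx') hne

theorem card_lrPatterns_comm {d : ℕ} {α β γ : ℕ → ℤ} (hα : Antitone α)
    (hα0 : ∀ j, d ≤ j → α j = 0) (hβ : Antitone β) (hβ0 : ∀ j, d ≤ j → β j = 0)
    (hγ : Antitone fun i : Fin d => γ i) :
    Nat.card {x // IsLRPattern d α β γ x} = Nat.card {x // IsLRPattern d β α γ x} := by
  have h := coeff_alternant_mul_schurPoly hα hγ β
  rw [← alternant_zero_mul_schurPoly hα hα0, mul_right_comm, alternant_zero_mul_schurPoly hβ hβ0,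
    coeff_alternant_mul_schurPoly hβ hγ] at h
  exact_mod_cast h.symm

/-! ### Hives -/

/-- Hives of size `d`: triangular arrays satisfying the three families of rhombus inequalities, with
boundary differences `α` (left side), `β` (bottom) and `γ` (diagonal). They are extended by `0`, so
that distinct `H` are distinct hives. -/
structure IsHive (d : ℕ) (α β γ : ℕ → ℤ) (H : ℕ → ℕ → ℤ) : Prop where
  supp : ∀ i j, ¬ (j ≤ i ∧ i ≤ d) → H i j = 0
  left : ∀ i ≤ d, H i 0 = ∑ r ∈ range i, α r
  bottom : ∀ j ≤ d, H d j = ∑ r ∈ range d, α r + ∑ r ∈ range j, β r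
  diag : ∀ i ≤ d, H i i = ∑ r ∈ range i, γ r
  rhombus_nonneg : ∀ i j, j + 1 ≤ i → i + 1 ≤ d →
    H i (j + 1) - H i j ≤ H (i + 1) (j + 1) - H (i + 1) j
  rhombus_interlace : ∀ i j, j + 1 ≤ i → i + 1 ≤ d →
    H (i + 1) (j + 2) - H (i + 1) (j + 1) ≤ H i (j + 1) - H i j
  rhombus_dominant : ∀ i k, k ≤ i → i + 1 < d →
    H (i + 2) (k + 1) - H (i + 1) (k + 1) ≤ H (i + 1) k - H i k

/-- The hive of a pattern: the partial sums of its rows, added to the partial sums of `α`. -/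
def hiveOfPattern (d : ℕ) (α : ℕ → ℤ) (x : ℕ → ℕ → ℤ) (i j : ℕ) : ℤ :=
  if j ≤ i ∧ i ≤ d then ∑ r ∈ range i, α r + ∑ l ∈ range j, x i l else 0

/-- The pattern of a hive: the differences along its rows. -/
def patternOfHive (d : ℕ) (β : ℕ → ℤ) (H : ℕ → ℕ → ℤ) (i j : ℕ) : ℤ :=
  if d ≤ i then β j else if j < i then H i (j + 1) - H i j else 0

section Hive

variable {d : ℕ} {α β γ : ℕ → ℤ} {x H : ℕ → ℕ → ℤ} {i j : ℕ}

theorem hiveOfPattern_of_le (d : ℕ) (α : ℕ → ℤ) (x : ℕ → ℕ → ℤ) (hj : j ≤ i) (hi : i ≤ d) :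
    hiveOfPattern d α x i j = ∑ r ∈ range i, α r + ∑ l ∈ range j, x i l :=
  if_pos ⟨hj, hi⟩

theorem IsLRPattern.sum_add_rowSum (h : IsLRPattern d α β γ x) (hi : i ≤ d) :
    ∑ r ∈ range i, α r + rowSum d x i = ∑ r ∈ range i, γ r := by
  induction i with
  | zero => simp only [rowSum, h.pattern.zero, range_zero, sum_empty, sum_const_zero, add_zero]
  | succ i ih =>
    have hweight := h.weight ⟨i, hi⟩
    rw [gtWeight] at hweight
    rw [sum_range_succ, sum_range_succ, ← ih (by omega), ← hweight]
    ring

theorem IsLRPattern.isHive_hiveOfPattern (h : IsLRPattern d α β γ x) :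
    IsHive d α β γ (hiveOfPattern d α x) where
  supp i j hij := if_neg hij
  left i hi := by
    rw [hiveOfPattern_of_le d α x (Nat.zero_le _) hi, sum_range_zero, add_zero]
  bottom j hj := by
    rw [hiveOfPattern_of_le d α x hj le_rfl, sum_congr rfl fun l _ => h.pattern.top d le_rfl l]
  diag i hi := by
    rw [hiveOfPattern_of_le d α x le_rfl hi, h.pattern.sum_range_eq_rowSum (min_le_left i d),
      h.sum_add_rowSum hi]
  rhombus_nonneg i j hji hi := by
    have := h.pattern.le_succ i j
    simp only [hiveOfPattern_of_le d α x hji (by omega : i ≤ d),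
      hiveOfPattern_of_le d α x (by omega : j ≤ i) (by omega),
      hiveOfPattern_of_le d α x (by omega : j + 1 ≤ i + 1) hi,
      hiveOfPattern_of_le d α x (by omega : j ≤ i + 1) hi, sum_range_succ _ j]
    linarith
  rhombus_interlace i j hji hi := by
    have := h.pattern.succ_le i j
    simp only [hiveOfPattern_of_le d α x (by omega : j + 2 ≤ i + 1) hi,
      hiveOfPattern_of_le d α x (by omega : j + 1 ≤ i + 1) hi,
      hiveOfPattern_of_le d α x hji (by omega : i ≤ d),
      hiveOfPattern_of_le d α x (by omega : j ≤ i) (by omega), sum_range_succ _ j,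
      sum_range_succ _ (j + 1)]
    linarith
  rhombus_dominant i k hki hi := by
    have := h.dominant i hi k
    rw [DominantAt, sum_sub_distrib, sum_sub_distrib] at this
    rw [hiveOfPattern_of_le d α x (by omega) hi, hiveOfPattern_of_le d α x (by omega) hi.le,
      hiveOfPattern_of_le d α x (by omega) hi.le, hiveOfPattern_of_le d α x hki (by omega),
      sum_range_succ α (i + 1), sum_range_succ α i]
    linarith

theorem patternOfHive_of_depth_le (β : ℕ → ℤ) (H : ℕ → ℕ → ℤ) (hi : d ≤ i) (j : ℕ) :
    patternOfHive d β H i j = β j :=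
  if_pos hi

theorem patternOfHive_eq_zero (H : ℕ → ℕ → ℤ) (hβ0 : ∀ j, d ≤ j → β j = 0) (hj : i ≤ j) :
    patternOfHive d β H i j = 0 := by
  rw [patternOfHive]
  split_ifs with hi hlt
  exacts [hβ0 j (hi.trans hj), absurd hlt hj.not_gt, rfl]

namespace IsHive

theorem patternOfHive_eq (h : IsHive d α β γ H) (hi : i ≤ d) (hj : j < i) :
    patternOfHive d β H i j = H i (j + 1) - H i j := by
  rcases hi.eq_or_lt with rfl | hlt
  · rw [patternOfHive_of_depth_le β H le_rfl, h.bottom _ hj, h.bottom _ hj.le, sum_range_succ]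
    ring
  · rw [patternOfHive, if_neg hlt.not_ge, if_pos hj]

theorem sum_patternOfHive (h : IsHive d α β γ H) (hi : i ≤ d) (hj : j ≤ i) :
    ∑ l ∈ range j, patternOfHive d β H i l = H i j - H i 0 := by
  rw [sum_congr rfl fun l hl => h.patternOfHive_eq hi ((mem_range.1 hl).trans_le hj),
    sum_range_sub]

theorem patternOfHive_succ_le (h : IsHive d α β γ H) (hβ : Antitone β)
    (hβ0 : ∀ j, d ≤ j → β j = 0) (i j : ℕ) :
    patternOfHive d β H (i + 1) (j + 1) ≤ patternOfHive d β H i j := by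
  rcases le_or_gt d i with hi | hi
  · rw [patternOfHive_of_depth_le β H hi, patternOfHive_of_depth_le β H (by omega)]
    exact hβ j.le_succ
  rcases lt_or_ge j i with hj | hj
  · rw [h.patternOfHive_eq hi (by omega), h.patternOfHive_eq hi.le hj]
    exact h.rhombus_interlace i j hj hi
  · rw [patternOfHive_eq_zero H hβ0 (by omega), patternOfHive_eq_zero H hβ0 hj]

theorem patternOfHive_diag_nonneg (h : IsHive d α β γ H) (hβ : Antitone β)
    (hβ0 : ∀ j, d ≤ j → β j = 0) (i : ℕ) : 0 ≤ patternOfHive d β H (i + 1) i := by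
  have hdiag : ∀ n, patternOfHive d β H (i + n + 1) (i + n) ≤ patternOfHive d β H (i + 1) i :=
    fun n => by
      induction n with
      | zero => exact le_rfl
      | succ n ih => exact (h.patternOfHive_succ_le hβ hβ0 _ _).trans ih
  refine le_of_eq_of_le ?_ (hdiag d)
  rw [patternOfHive_of_depth_le β H (by omega), hβ0 _ (Nat.le_add_left d i)]

theorem isGTPattern_patternOfHive (h : IsHive d α β γ H) (hβ : Antitone β)
    (hβ0 : ∀ j, d ≤ j → β j = 0) : IsGTPattern d β (patternOfHive d β H) where
  zero j := patternOfHive_eq_zero H hβ0 (Nat.zero_le j)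
  top _ hi j := patternOfHive_of_depth_le β H hi j
  interlaces i j := by
    refine ⟨?_, h.patternOfHive_succ_le hβ hβ0 i j⟩
    rcases le_or_gt d i with hi | hi
    · rw [patternOfHive_of_depth_le β H hi, patternOfHive_of_depth_le β H (by omega)]
    rcases lt_trichotomy j i with hj | rfl | hj
    · rw [h.patternOfHive_eq hi.le hj, h.patternOfHive_eq hi (by omega)]
      exact h.rhombus_nonneg i j hj hi
    · rw [patternOfHive_eq_zero H hβ0 le_rfl]
      exact h.patternOfHive_diag_nonneg hβ hβ0 j
    · rw [patternOfHive_eq_zero H hβ0 hj.le, patternOfHive_eq_zero H hβ0 hj]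

end IsHive

theorem IsGTPattern.rowDominant_of_le (h : IsGTPattern d β x)
    (hdom : ∀ i k, i + 1 < d → k ≤ i → DominantAt α x i k) : RowDominant d α x := by
  intro i hi k
  rcases le_total k i with hk | hk
  · exact hdom i k hi hk
  · induction k, hk using Nat.le_induction with
    | base => exact hdom i i hi le_rfl
    | succ k hk ih =>
      have hstep : x (i + 2) (k + 1) - x (i + 1) (k + 1) ≤ x (i + 1) k - x i k := by
        rw [h.eq_zero_of_le (show i + 1 ≤ k + 1 by omega), h.eq_zero_of_le hk, sub_zero, sub_zero]
        exact h.succ_le (i + 1) k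
      rw [DominantAt] at ih ⊢
      rw [sum_range_succ _ (k + 1), sum_range_succ (fun j => x (i + 1) j - x i j)]
      linarith

theorem IsHive.dominantAt_patternOfHive (h : IsHive d α β γ H) {k : ℕ} (hi : i + 1 < d)
    (hk : k ≤ i) : DominantAt α (patternOfHive d β H) i k := by
  have := h.rhombus_dominant i k hk hi
  rw [DominantAt, sum_sub_distrib, sum_sub_distrib, h.sum_patternOfHive hi (by omega),
    h.sum_patternOfHive hi.le (by omega), h.sum_patternOfHive hi.le (by omega),
    h.sum_patternOfHive (by omega) hk, h.left _ hi, h.left _ hi.le, h.left _ (by omega),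
    sum_range_succ α (i + 1), sum_range_succ α i]
  linarith

theorem IsHive.isLRPattern_patternOfHive (h : IsHive d α β γ H) (hβ : Antitone β)
    (hβ0 : ∀ j, d ≤ j → β j = 0) : IsLRPattern d α β γ (patternOfHive d β H) := by
  have hpattern := h.isGTPattern_patternOfHive hβ hβ0
  have hrow : ∀ i ≤ d, rowSum d (patternOfHive d β H) i =
      ∑ r ∈ range i, γ r - ∑ r ∈ range i, α r := fun i hi => by
    rw [← hpattern.sum_range_eq_rowSum (min_le_left i d), h.sum_patternOfHive hi le_rfl,
      h.diag i hi, h.left i hi]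
  refine ⟨hpattern, hpattern.rowDominant_of_le fun i k => h.dominantAt_patternOfHive, fun i => ?_⟩
  rw [gtWeight, hrow _ i.2, hrow _ i.2.le, sum_range_succ, sum_range_succ]
  ring

theorem IsLRPattern.patternOfHive_hiveOfPattern (h : IsLRPattern d α β γ x) :
    patternOfHive d β (hiveOfPattern d α x) = x := by
  funext i j
  rcases le_or_gt d i with hi | hi
  · rw [patternOfHive_of_depth_le _ _ hi, h.pattern.top i hi]
  rcases lt_or_ge j i with hj | hj
  · rw [h.isHive_hiveOfPattern.patternOfHive_eq hi.le hj, hiveOfPattern_of_le d α x hj hi.le,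
      hiveOfPattern_of_le d α x hj.le hi.le, sum_range_succ]
    ring
  · rw [patternOfHive, if_neg hi.not_ge, if_neg hj.not_gt, h.pattern.eq_zero_of_le hj]

theorem IsHive.hiveOfPattern_patternOfHive (h : IsHive d α β γ H) :
    hiveOfPattern d α (patternOfHive d β H) = H := by
  funext i j
  rw [hiveOfPattern]
  split_ifs with hij
  · rw [h.sum_patternOfHive hij.2 hij.1, h.left i hij.2]
    ring
  · rw [h.supp i j hij]

theorem card_lrPatterns_eq_card_hives (hβ : Antitone β) (hβ0 : ∀ j, d ≤ j → β j = 0) :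
    Nat.card {x // IsLRPattern d α β γ x} = Nat.card {H // IsHive d α β γ H} :=
  Nat.card_congr
    { toFun := fun x => ⟨_, x.2.isHive_hiveOfPattern⟩
      invFun := fun H => ⟨_, H.2.isLRPattern_patternOfHive hβ hβ0⟩
      left_inv := fun x => Subtype.ext x.2.patternOfHive_hiveOfPattern
      right_inv := fun H => Subtype.ext H.2.hiveOfPattern_patternOfHive }

/-- The reflection of a triangular array that exchanges the ends of its left side, normalized at the
apex, with the linear function `k i - m j` added. -/
def reflectHive (d : ℕ) (k m : ℤ) (H : ℕ → ℕ → ℤ) (i j : ℕ) : ℤ :=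
  if j ≤ i ∧ i ≤ d then H (d - i + j) j - H d 0 + k * i - m * j else 0

theorem reflectHive_of_le (k m : ℤ) (H : ℕ → ℕ → ℤ) (hj : j ≤ i) (hi : i ≤ d) :
    reflectHive d k m H i j = H (d - i + j) j - H d 0 + k * i - m * j :=
  if_pos ⟨hj, hi⟩

namespace IsHive

variable {k m : ℤ} {α' β' γ' : ℕ → ℤ}

theorem reflectHive_left (h : IsHive d α β γ H) (m : ℤ)
    (hα' : ∀ r < d, α' r = k - α (d - 1 - r)) (hi : i ≤ d) :
    reflectHive d k m H i 0 = ∑ r ∈ range i, α' r := by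
  rw [reflectHive_of_le k m H (Nat.zero_le _) hi, add_zero, h.left _ (Nat.sub_le d i),
    h.left _ le_rfl]
  induction i with
  | zero => simp
  | succ i ih =>
    have hsplit : ∑ r ∈ range (d - i), α r = ∑ r ∈ range (d - (i + 1)), α r + α (d - 1 - i) := by
      rw [show d - i = d - (i + 1) + 1 by omega, sum_range_succ, Nat.add_comm i 1, Nat.sub_add_eq]
    rw [sum_range_succ, ← ih (by omega), hα' i hi, hsplit]
    push_cast
    ring

theorem reflectHive_rhombus_nonneg (h : IsHive d α β γ H) (k m : ℤ) (hji : j + 1 ≤ i)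
    (hi : i + 1 ≤ d) :
    reflectHive d k m H i (j + 1) - reflectHive d k m H i j ≤
      reflectHive d k m H (i + 1) (j + 1) - reflectHive d k m H (i + 1) j := by
  have := h.rhombus_dominant (d - (i + 1) + j) j (by omega) (by omega)
  rw [reflectHive_of_le k m H hji (by omega), reflectHive_of_le k m H (by omega) (by omega),
    reflectHive_of_le k m H (by omega) hi, reflectHive_of_le k m H (by omega) hi,
    show d - i + (j + 1) = d - (i + 1) + j + 2 by omega,
    show d - i + j = d - (i + 1) + j + 1 by omega, ← add_assoc (d - (i + 1)) j 1]
  push_cast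
  linarith

theorem reflectHive_rhombus_interlace (h : IsHive d α β γ H) (k m : ℤ) (hji : j + 1 ≤ i)
    (hi : i + 1 ≤ d) :
    reflectHive d k m H (i + 1) (j + 2) - reflectHive d k m H (i + 1) (j + 1) ≤
      reflectHive d k m H i (j + 1) - reflectHive d k m H i j := by
  have := h.rhombus_interlace (d - i + j) j (by omega) (by omega)
  rw [reflectHive_of_le k m H (by omega) hi, reflectHive_of_le k m H (by omega) hi,
    reflectHive_of_le k m H hji (by omega), reflectHive_of_le k m H (by omega) (by omega),
    show d - (i + 1) + (j + 2) = d - i + j + 1 by omega,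
    show d - (i + 1) + (j + 1) = d - i + j by omega, ← add_assoc (d - i) j 1]
  push_cast
  linarith

theorem reflectHive_rhombus_dominant (h : IsHive d α β γ H) (k m : ℤ) (hji : j ≤ i)
    (hi : i + 1 < d) :
    reflectHive d k m H (i + 2) (j + 1) - reflectHive d k m H (i + 1) (j + 1) ≤
      reflectHive d k m H (i + 1) j - reflectHive d k m H i j := by
  have := h.rhombus_nonneg (d - (i + 1) + j) j (by omega) (by omega)
  rw [reflectHive_of_le k m H (by omega) hi, reflectHive_of_le k m H (by omega) hi.le,
    reflectHive_of_le k m H (by omega) hi.le, reflectHive_of_le k m H hji (by omega),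
    show d - (i + 2) + (j + 1) = d - (i + 1) + j by omega,
    show d - i + j = d - (i + 1) + j + 1 by omega, ← add_assoc (d - (i + 1)) j 1]
  push_cast
  linarith

theorem isHive_reflectHive (h : IsHive d α β γ H)
    (hα' : ∀ r < d, α' r = k - α (d - 1 - r)) (hβ' : ∀ r < d, β' r = γ r - m)
    (hγ' : ∀ r < d, γ' r = β r + k - m) : IsHive d α' β' γ' (reflectHive d k m H) where
  supp i j hij := if_neg hij
  left i hi := h.reflectHive_left m hα' hi
  bottom j hj := by
    rw [← h.reflectHive_left m hα' le_rfl, reflectHive_of_le k m H hj le_rfl,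
      reflectHive_of_le k m H (Nat.zero_le _) le_rfl, Nat.sub_self, zero_add, zero_add,
      h.diag j hj, h.left 0 (Nat.zero_le _),
      sum_congr rfl fun r hr => hβ' r ((mem_range.1 hr).trans_le hj), sum_sub_distrib]
    simp only [range_zero, sum_empty, sum_const, card_range, nsmul_eq_mul, Nat.cast_zero]
    ring
  diag i hi := by
    rw [reflectHive_of_le k m H le_rfl hi, Nat.sub_add_cancel hi, h.bottom i hi, h.left d le_rfl,
      sum_congr rfl fun r hr => hγ' r ((mem_range.1 hr).trans_le hi), sum_sub_distrib,
      sum_add_distrib]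
    simp only [sum_const, card_range, nsmul_eq_mul]
    ring
  rhombus_nonneg _ _ := h.reflectHive_rhombus_nonneg k m
  rhombus_interlace _ _ := h.reflectHive_rhombus_interlace k m
  rhombus_dominant _ _ := h.reflectHive_rhombus_dominant k m

theorem reflectHive_reflectHive (h : IsHive d α β γ H) (k m : ℤ) :
    reflectHive d k (k - m) (reflectHive d k m H) = H := by
  funext i j
  by_cases hij : j ≤ i ∧ i ≤ d
  · obtain ⟨hj, hi⟩ := hij
    rw [reflectHive_of_le _ _ _ hj hi, reflectHive_of_le _ _ _ (by omega) (by omega),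
      reflectHive_of_le _ _ _ (Nat.zero_le d) le_rfl, show d - (d - i + j) + j = i by omega,
      Nat.sub_self, zero_add, h.left 0 (Nat.zero_le _), sum_range_zero, Nat.cast_add,
      Nat.cast_sub hi, Nat.cast_zero]
    ring
  · rw [h.supp i j hij]
    exact if_neg hij

end IsHive

theorem card_hives_reflect {k m : ℤ} {α' β' γ' : ℕ → ℤ}
    (hα' : ∀ r < d, α' r = k - α (d - 1 - r)) (hβ' : ∀ r < d, β' r = γ r - m)
    (hγ' : ∀ r < d, γ' r = β r + k - m) :
    Nat.card {H // IsHive d α β γ H} = Nat.card {H // IsHive d α' β' γ' H} :=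
  have hα : ∀ r < d, α r = k - α' (d - 1 - r) := fun r hr => by
    rw [hα' _ (by omega), show d - 1 - (d - 1 - r) = r by omega, sub_sub_cancel]
  have hβ : ∀ r < d, β r = γ' r - (k - m) := fun r hr => by rw [hγ' r hr]; ring
  have hγ : ∀ r < d, γ r = β' r + k - (k - m) := fun r hr => by rw [hβ' r hr]; ring
  Nat.card_congr
    { toFun := fun H => ⟨_, H.2.isHive_reflectHive hα' hβ' hγ'⟩
      invFun := fun H => ⟨_, H.2.isHive_reflectHive hα hβ hγ⟩
      left_inv := fun H => Subtype.ext (H.2.reflectHive_reflectHive k m)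
      right_inv := fun H => Subtype.ext (by
        simpa only [sub_sub_cancel] using H.2.reflectHive_reflectHive k (k - m)) }

end Hive

/-! ### Tuples, words and intervals -/

/-- A `d`-tuple, extended by zeros. -/
def extendZero {d : ℕ} (K : Fin d → ℤ) (n : ℕ) : ℤ := if h : n < d then K ⟨n, h⟩ else 0

theorem extendZero_val {d : ℕ} (K : Fin d → ℤ) (i : Fin d) : extendZero K i = K i := dif_pos i.2

theorem extendZero_of_le {d : ℕ} (K : Fin d → ℤ) {n : ℕ} (h : d ≤ n) : extendZero K n = 0 :=
  dif_neg h.not_gt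

theorem IsPartition.antitone_extendZero {d : ℕ} {K : Fin d → ℤ} (h : IsPartition K) :
    Antitone (extendZero K) := by
  intro a b hab
  rcases lt_or_ge b d with hb | hb
  · rw [extendZero_val K ⟨b, hb⟩, extendZero_val K ⟨a, hab.trans_lt hb⟩]
    exact h.1 hab
  · rw [extendZero_of_le K hb, extendZero]
    split_ifs
    exacts [h.2 _, le_rfl]

theorem countP_map_range_sub {X : Type*} (f : ℤ → X) (p : X → Bool) (b : ℤ) (n : ℕ) :
    ((List.range n).map fun s : ℕ => f (b - s)).countP p = #{c ∈ Ioc (b - n) b | p (f c)} := by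
  induction n with
  | zero => simp
  | succ n ih =>
    have hIoc : Ioc (b - (n + 1 : ℕ)) b = insert (b - n) (Ioc (b - n) b) := by
      ext c
      simp only [mem_Ioc, mem_insert]
      push_cast
      omega
    rw [List.range_succ, List.map_append, List.countP_append, ih, hIoc, filter_insert,
      List.map_singleton, List.countP_singleton]
    split_ifs
    · rw [card_insert_of_notMem (by simp)]
    · rfl

theorem sum_count_succ_eq_countP (w : List ℕ) (k : ℕ) :
    ∑ l ∈ range k, w.count (l + 1) = w.countP fun a => 0 < a ∧ a ≤ k := by
  induction w with
  | nil => simp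
  | cons a w ih =>
    simp only [List.count_cons, List.countP_cons, sum_add_distrib, ih, beq_iff_eq,
      decide_eq_true_eq]
    cases a <;> simp

theorem filter_le_prefix_of_pairwise_ge {r : List ℕ} (hr : r.Pairwise (· ≥ ·)) (b : ℕ) :
    r.filter (b ≤ ·) <+: r := by
  induction r with
  | nil => exact List.prefix_refl _
  | cons a r ih =>
    obtain ⟨ha, hr⟩ := List.pairwise_cons.1 hr
    rcases le_or_gt b a with hba | hba
    · rw [List.filter_cons_of_pos (by simpa using hba)]
      exact (List.prefix_cons_inj a).2 (ih hr)
    · rw [List.filter_eq_nil_iff.2]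
      · exact List.nil_prefix
      · intro c hc
        have hca : c ≤ a := (List.mem_cons.1 hc).elim le_of_eq (ha c)
        simpa using hca.trans_lt hba

theorem forall_prefix_append_count_le_iff {a b : ℕ} (hab : a < b) (u : List ℕ) {r : List ℕ}
    (hr : r.Pairwise (· ≥ ·)) :
    (∀ v, v <+: u ++ r → v.count b ≤ v.count a) ↔
      (∀ v, v <+: u → v.count b ≤ v.count a) ∧ (u ++ r).count b ≤ u.count a := by
  constructor
  · -- The letters from `b` on form a prefix of `r`, the critical one for the inequality.
    refine fun h => ⟨fun v hv => h v (hv.trans (List.prefix_append u r)), ?_⟩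
    have hcount := h (u ++ r.filter (b ≤ ·))
      ((List.prefix_append_right_inj u).2 (filter_le_prefix_of_pairwise_ge hr b))
    have hzero : (r.filter (b ≤ ·)).count a = 0 :=
      List.count_eq_zero.2 fun ha => hab.not_ge (of_decide_eq_true (List.mem_filter.1 ha).2)
    rwa [List.count_append, List.count_append, hzero, List.count_filter (by simp),
      ← List.count_append] at hcount
  · rintro ⟨hu, hur⟩ v hv
    rcases List.prefix_or_prefix_of_prefix hv (List.prefix_append u r) with hvu | huv
    · exact hu v hvu
    · exact (hv.count_le b).trans (hur.trans (huv.count_le a))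

theorem mem_iff_le_add_card_of_lower {a b : ℤ} {A : Finset ℤ} (hA : A ⊆ Ioc a b)
    (hlower : ∀ c ∈ A, ∀ c', a < c' → c' ≤ c → c' ∈ A) {c : ℤ} (hc : a < c) :
    c ∈ A ↔ c ≤ a + #A := by
  constructor
  · intro hmem
    have hcard := card_le_card fun c' hc' =>
      hlower c hmem c' (mem_Ioc.1 hc').1 (mem_Ioc.1 hc').2
    rw [Int.card_Ioc] at hcard
    omega
  · intro hle
    by_contra hmem
    have hsub : A ⊆ Ioc a (c - 1) := fun c' hc' => by
      rw [mem_Ioc, Int.le_sub_one_iff]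
      exact ⟨(mem_Ioc.1 (hA hc')).1, not_le.1 fun hcc' => hmem (hlower c' hc' c hc hcc')⟩
    have hcard := card_le_card hsub
    rw [Int.card_Ioc] at hcard
    omega

/-! ### Fillings and patterns -/

/-- In the tableau of inner shape `α` in which row `i` has `x (i + 1) l - x i l` letters `l + 1`,
the last column of row `i` that is not occupied by a letter greater than `k`. -/
def columnBound (α : ℕ → ℤ) (x : ℕ → ℕ → ℤ) (i k : ℕ) : ℤ :=
  α i + ∑ l ∈ range k, (x (i + 1) l - x i l)

theorem columnBound_zero (α : ℕ → ℤ) (x : ℕ → ℕ → ℤ) (i : ℕ) : columnBound α x i 0 = α i := by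
  rw [columnBound, sum_range_zero, add_zero]

theorem columnBound_succ (α : ℕ → ℤ) (x : ℕ → ℕ → ℤ) (i k : ℕ) :
    columnBound α x i (k + 1) = columnBound α x i k + (x (i + 1) k - x i k) := by
  rw [columnBound, sum_range_succ, columnBound, add_assoc]

theorem columnBound_depth {d : ℕ} (α : ℕ → ℤ) (x : ℕ → ℕ → ℤ) (i : Fin d) :
    columnBound α x i d = α i + gtWeight d x i := by
  rw [columnBound, sum_sub_distrib, gtWeight, rowSum, rowSum]

section Words

variable {d : ℕ} (outer inner : Fin d → ℤ) (T : Fin d → ℤ → ℕ)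

/-- Row `i` of a filling of `outer / inner`, read from right to left. -/
def rowWord (i : Fin d) : List ℕ :=
  (List.range (outer i - inner i).toNat).map fun s : ℕ => T i (outer i - s)

/-- The part of the reading word that comes from the first `n` rows. -/
def initialRows (n : ℕ) : List ℕ := ((List.finRange d).take n).flatMap (rowWord outer inner T)

/-- The pattern of a filling: entry `l` of row `i` is the number of letters `l + 1` in the first `i`
rows of the filling. -/
def letterPattern (i l : ℕ) : ℤ := (initialRows outer inner T i).count (l + 1)

theorem countP_rowWord (p : ℕ → Bool) (i : Fin d) :
    (rowWord outer inner T i).countP p = #{c ∈ Ioc (inner i) (outer i) | p (T i c)} := by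
  rw [rowWord, countP_map_range_sub (T i)]
  congr 2
  ext c
  simp only [mem_Ioc]
  omega

theorem initialRows_of_le {n : ℕ} (hn : d ≤ n) :
    initialRows outer inner T n = readingWord outer inner T := by
  rw [initialRows, List.take_of_length_le (by rwa [List.length_finRange])]
  simp only [readingWord, bind_pure_comp, List.map_eq_map, List.map_map]
  rfl

theorem initialRows_succ (i : Fin d) :
    initialRows outer inner T (i + 1) =
      initialRows outer inner T i ++ rowWord outer inner T i := by
  rw [initialRows, List.take_add_one, List.flatMap_append, ← initialRows,
    List.getElem?_eq_getElem (by simp)]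
  simp

theorem initialRows_prefix_succ (n : ℕ) :
    initialRows outer inner T n <+: initialRows outer inner T (n + 1) := by
  rw [initialRows, initialRows, List.take_add_one, List.flatMap_append]
  exact List.prefix_append _ _

theorem letterPattern_zero (l : ℕ) : letterPattern outer inner T 0 l = 0 := by
  simp [letterPattern, initialRows]

theorem letterPattern_succ_sub (i : Fin d) (l : ℕ) :
    letterPattern outer inner T (i + 1) l - letterPattern outer inner T i l =
      (rowWord outer inner T i).count (l + 1) := by
  rw [letterPattern, letterPattern, initialRows_succ, List.count_append, Nat.cast_add,
    add_sub_cancel_left]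

end Words

namespace IsSkewSSYT

variable {d : ℕ} {outer inner : Fin d → ℤ} {T : Fin d → ℤ → ℕ}

theorem pairwise_ge_rowWord (h : IsSkewSSYT outer inner T) (i : Fin d) :
    (rowWord outer inner T i).Pairwise (· ≥ ·) := by
  refine List.pairwise_map.2 (List.pairwise_lt_range.imp_of_mem fun {s t} hs ht hst => ?_)
  rw [List.mem_range] at hs ht
  exact h.row_weak i _ _ ⟨by omega, by omega⟩ ⟨by omega, by omega⟩ (by omega)

theorem forall_prefix_initialRows_count_le_iff (h : IsSkewSSYT outer inner T) (l : ℕ) {n : ℕ}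
    (hn : n ≤ d) :
    (∀ v, v <+: initialRows outer inner T n → v.count (l + 2) ≤ v.count (l + 1)) ↔
      ∀ i < n, letterPattern outer inner T (i + 1) (l + 1) ≤ letterPattern outer inner T i l := by
  induction n with
  | zero => simp [initialRows]
  | succ n ih =>
    rw [initialRows_succ outer inner T ⟨n, hn⟩,
      forall_prefix_append_count_le_iff (by omega) _ (h.pairwise_ge_rowWord _),
      ih (Nat.le_of_succ_le hn), ← initialRows_succ, Nat.forall_lt_succ_right, letterPattern,
      letterPattern, Nat.cast_le]

theorem isLatticeWord_iff (h : IsSkewSSYT outer inner T) :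
    IsLatticeWord d (readingWord outer inner T) ↔ ∀ l, l + 2 ≤ d → ∀ i < d,
      letterPattern outer inner T (i + 1) (l + 1) ≤ letterPattern outer inner T i l := by
  simp only [← h.forall_prefix_initialRows_count_le_iff _ le_rfl]
  rw [initialRows_of_le outer inner T le_rfl]
  constructor
  · exact fun hw l hl v hv => hw v hv (l + 1) (Nat.succ_pos l) hl
  · rintro hw v hv (_ | l) hl hld
    · exact absurd hl (Nat.not_succ_le_zero 0)
    · exact hw l hld v hv

theorem letterPattern_eq_zero (h : IsSkewSSYT outer inner T) (i : ℕ) {l : ℕ} (hl : d ≤ l) :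
    letterPattern outer inner T i l = 0 := by
  rw [letterPattern, Nat.cast_eq_zero, List.count_eq_zero, initialRows, List.mem_flatMap]
  rintro ⟨r, -, hr⟩
  obtain ⟨s, hs, hT⟩ := List.mem_map.1 hr
  rw [List.mem_range] at hs
  have hle := (h.entries r (outer r - s) ⟨by omega, by omega⟩).2
  omega

theorem columnBound_letterPattern (h : IsSkewSSYT outer inner T) (i : Fin d) (k : ℕ) :
    columnBound (extendZero inner) (letterPattern outer inner T) i k =
      inner i + #{c ∈ Ioc (inner i) (outer i) | T i c ≤ k} := by
  simp only [columnBound, letterPattern_succ_sub, extendZero_val]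
  rw [← Nat.cast_sum, sum_count_succ_eq_countP, countP_rowWord]
  congr 3
  refine filter_congr fun c hc => ?_
  have hpos := (h.entries i c (mem_Ioc.1 hc)).1
  simp only [decide_eq_true_eq]
  omega

theorem columnBound_letterPattern_depth (h : IsSkewSSYT outer inner T) {i : Fin d}
    (hio : inner i ≤ outer i) :
    columnBound (extendZero inner) (letterPattern outer inner T) i d = outer i := by
  rw [h.columnBound_letterPattern,
    filter_true_of_mem fun c hc => (h.entries i c (mem_Ioc.1 hc)).2, Int.card_Ioc]
  omega

theorem entry_le_iff (h : IsSkewSSYT outer inner T) {i : Fin d} {c : ℤ}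
    (hc : InSkew outer inner i c) (k : ℕ) :
    T i c ≤ k ↔ c ≤ columnBound (extendZero inner) (letterPattern outer inner T) i k := by
  rw [h.columnBound_letterPattern,
    ← mem_iff_le_add_card_of_lower (filter_subset _ _) (fun c₁ h₁ c₂ hc₂ hle => ?_) hc.1,
    mem_filter, and_iff_right (mem_Ioc.2 hc)]
  rw [mem_filter, mem_Ioc] at h₁ ⊢
  have hc₂' : InSkew outer inner i c₂ := ⟨hc₂, hle.trans h₁.1.2⟩
  exact ⟨hc₂', (h.row_weak i c₂ c₁ hc₂' h₁.1 hle).trans h₁.2⟩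

theorem columnBound_letterPattern_succ_le (h : IsSkewSSYT outer inner T) (ho : Antitone outer)
    (hi : Antitone inner) {i i' : Fin d} (hii : i < i') (hio : inner i' ≤ outer i') (k : ℕ) :
    columnBound (extendZero inner) (letterPattern outer inner T) i' (k + 1) ≤
      columnBound (extendZero inner) (letterPattern outer inner T) i k := by
  set c := columnBound (extendZero inner) (letterPattern outer inner T) i' (k + 1) with hc
  rcases le_or_gt c (inner i) with hci | hci
  · rw [h.columnBound_letterPattern]
    omega
  · have hco : c ≤ outer i' := by
      have hcard := card_filter_le (Ioc (inner i') (outer i')) fun c => T i' c ≤ k + 1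
      rw [Int.card_Ioc] at hcard
      rw [hc, h.columnBound_letterPattern]
      omega
    have hlower : InSkew outer inner i' c := ⟨(hi hii.le).trans_lt hci, hco⟩
    have hupper : InSkew outer inner i c := ⟨hci, hco.trans (ho hii.le)⟩
    exact (h.entry_le_iff hupper k).1 (Nat.le_of_lt_succ
      ((h.col_strict i i' c hupper hlower hii).trans_le ((h.entry_le_iff hlower _).2 hc.le)))

theorem eq_of_letterPattern_eq {T' : Fin d → ℤ → ℕ} (h : IsSkewSSYT outer inner T)
    (h' : IsSkewSSYT outer inner T')
    (heq : letterPattern outer inner T = letterPattern outer inner T') : T = T' := by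
  funext i c
  by_cases hc : InSkew outer inner i c
  · exact eq_of_forall_ge_iff fun k => by rw [h.entry_le_iff hc, h'.entry_le_iff hc, heq]
  · rw [h.zeros i c hc, h'.zeros i c hc]

end IsSkewSSYT

section Tableaux

variable {d : ℕ} {outer inner type : Fin d → ℤ} {T : Fin d → ℤ → ℕ} {x : ℕ → ℕ → ℤ}

theorem IsLRTableau.letterPattern_of_depth_le (h : IsLRTableau outer inner type T) {i : ℕ}
    (hi : d ≤ i) (l : ℕ) : letterPattern outer inner T i l = extendZero type l := by
  rcases lt_or_ge l d with hl | hl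
  · rw [letterPattern, initialRows_of_le outer inner T hi, h.content ⟨l, hl⟩,
      ← extendZero_val type ⟨l, hl⟩]
  · rw [extendZero_of_le type hl, h.ssyt.letterPattern_eq_zero i hl]

theorem IsLRTableau.isGTPattern_letterPattern (h : IsLRTableau outer inner type T)
    (ht : IsPartition type) :
    IsGTPattern d (extendZero type) (letterPattern outer inner T) := by
  refine ⟨letterPattern_zero outer inner T, fun i => h.letterPattern_of_depth_le,
    fun i l => ⟨Nat.cast_le.2 ((initialRows_prefix_succ outer inner T i).count_le _), ?_⟩⟩
  rcases le_or_gt d i with hi | hi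
  · rw [h.letterPattern_of_depth_le hi, h.letterPattern_of_depth_le (Nat.le_succ_of_le hi)]
    exact ht.antitone_extendZero l.le_succ
  rcases le_or_gt d (l + 1) with hl | hl
  · rw [h.ssyt.letterPattern_eq_zero _ hl]
    exact Nat.cast_nonneg _
  · exact h.ssyt.isLatticeWord_iff.1 h.lattice l hl i hi

theorem IsLRTableau.isLRPattern_letterPattern (h : IsLRTableau outer inner type T)
    (ho : Antitone outer) (hi : Antitone inner) (ht : IsPartition type) (hio : inner ≤ outer) :
    IsLRPattern d (extendZero inner) (extendZero type) (extendZero outer)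
      (letterPattern outer inner T) where
  pattern := h.isGTPattern_letterPattern ht
  dominant i hid k := h.ssyt.columnBound_letterPattern_succ_le ho hi
    (i := ⟨i, Nat.lt_of_succ_lt hid⟩) (i' := ⟨i + 1, hid⟩) (Nat.lt_succ_self i) (hio _) k
  weight i := by
    rw [← columnBound_depth, h.ssyt.columnBound_letterPattern_depth (hio i), extendZero_val]

open Classical in
/-- The filling of `outer / inner` in which row `i` has `x (i + 1) l - x i l` letters `l + 1`, in
weakly increasing order. -/
noncomputable def tableauOfPattern (outer inner : Fin d → ℤ) (x : ℕ → ℕ → ℤ) (i : Fin d)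
    (c : ℤ) : ℕ :=
  if InSkew outer inner i c then sInf {k | c ≤ columnBound (extendZero inner) x i k} else 0

namespace IsLRPattern

theorem monotone_columnBound {α β γ : ℕ → ℤ} (h : IsLRPattern d α β γ x) (i : ℕ) :
    Monotone (columnBound α x i) :=
  monotone_nat_of_le_succ fun k => by
    rw [columnBound_succ]
    exact le_add_of_nonneg_right (sub_nonneg.2 (h.pattern.le_succ i k))

theorem columnBound_of_depth_le {α β γ : ℕ → ℤ} (h : IsLRPattern d α β γ x) (i : Fin d) {k : ℕ}
    (hk : d ≤ k) : columnBound α x i k = γ i := by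
  rw [← h.weight i, columnBound, sum_sub_distrib,
    h.pattern.sum_range_eq_rowSum ((min_le_right _ _).trans hk),
    h.pattern.sum_range_eq_rowSum ((min_le_right _ _).trans hk), gtWeight]

theorem columnBound_le {α β γ : ℕ → ℤ} (h : IsLRPattern d α β γ x) (i : Fin d) (k : ℕ) :
    columnBound α x i k ≤ γ i := by
  rw [← h.columnBound_of_depth_le i (le_max_right k d)]
  exact h.monotone_columnBound i (le_max_left k d)

theorem le_columnBound {α β γ : ℕ → ℤ} (h : IsLRPattern d α β γ x) (i k : ℕ) :
    α i ≤ columnBound α x i k := by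
  rw [← columnBound_zero α x i]
  exact h.monotone_columnBound i k.zero_le

theorem columnBound_succ_le {α β γ : ℕ → ℤ} (h : IsLRPattern d α β γ x) {i i' : ℕ} (hii : i < i')
    (hi' : i' < d) (k : ℕ) : columnBound α x i' (k + 1) ≤ columnBound α x i k := by
  induction i', hii using Nat.le_induction with
  | base => exact h.dominant i hi' k
  | succ n _ ih =>
    exact (h.dominant n hi' k).trans
      ((h.monotone_columnBound n k.le_succ).trans (ih (Nat.lt_of_succ_lt hi')))

variable (h : IsLRPattern d (extendZero inner) (extendZero type) (extendZero outer) x)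

include h

theorem inner_le_outer : inner ≤ outer := fun i => by
  have hle := (h.le_columnBound i d).trans (h.columnBound_le i d)
  rwa [extendZero_val, extendZero_val] at hle

theorem tableauOfPattern_le_iff {i : Fin d} {c : ℤ} (hc : InSkew outer inner i c) (k : ℕ) :
    tableauOfPattern outer inner x i c ≤ k ↔ c ≤ columnBound (extendZero inner) x i k := by
  rw [tableauOfPattern, if_pos hc]
  have hne : {k | c ≤ columnBound (extendZero inner) x i k}.Nonempty :=
    ⟨d, hc.2.trans_eq ((extendZero_val outer i).symm.trans
      (h.columnBound_of_depth_le i le_rfl).symm)⟩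
  exact ⟨fun hk => (Nat.sInf_mem hne).trans (h.monotone_columnBound i hk),
    fun hk => Nat.sInf_le hk⟩

theorem tableauOfPattern_pos {i : Fin d} {c : ℤ} (hc : InSkew outer inner i c) :
    0 < tableauOfPattern outer inner x i c := by
  rw [← not_le, h.tableauOfPattern_le_iff hc, columnBound_zero, extendZero_val, not_le]
  exact hc.1

theorem isSkewSSYT_tableauOfPattern :
    IsSkewSSYT outer inner (tableauOfPattern outer inner x) where
  zeros i j hij := if_neg hij
  entries i j hij := by
    refine ⟨h.tableauOfPattern_pos hij, (h.tableauOfPattern_le_iff hij d).2 ?_⟩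
    rw [h.columnBound_of_depth_le i le_rfl, extendZero_val]
    exact hij.2
  row_weak i j j' hj hj' hle :=
    (h.tableauOfPattern_le_iff hj _).2 (hle.trans ((h.tableauOfPattern_le_iff hj' _).1 le_rfl))
  col_strict i i' j hj hj' hii := by
    obtain ⟨k, hk⟩ := Nat.exists_eq_add_one_of_ne_zero (h.tableauOfPattern_pos hj').ne'
    have hle := (h.tableauOfPattern_le_iff hj' (k + 1)).1 hk.le
    rw [hk, Nat.lt_succ_iff, h.tableauOfPattern_le_iff hj]
    exact hle.trans (h.columnBound_succ_le hii i'.2 k)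

theorem columnBound_letterPattern_tableauOfPattern (i : Fin d) (k : ℕ) :
    columnBound (extendZero inner)
        (letterPattern outer inner (tableauOfPattern outer inner x)) i k =
      columnBound (extendZero inner) x i k := by
  have hinner := h.le_columnBound i k
  have houter := h.columnBound_le i k
  rw [extendZero_val] at hinner houter
  have hfilter : {c ∈ Ioc (inner i) (outer i) | tableauOfPattern outer inner x i c ≤ k} =
      Ioc (inner i) (columnBound (extendZero inner) x i k) := by
    ext c
    rw [mem_filter, mem_Ioc, mem_Ioc]
    exact ⟨fun hc => ⟨hc.1.1, (h.tableauOfPattern_le_iff hc.1 k).1 hc.2⟩, fun hc =>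
      ⟨⟨hc.1, hc.2.trans houter⟩,
        (h.tableauOfPattern_le_iff ⟨hc.1, hc.2.trans houter⟩ k).2 hc.2⟩⟩
  rw [h.isSkewSSYT_tableauOfPattern.columnBound_letterPattern, hfilter, Int.card_Ioc]
  omega

theorem letterPattern_tableauOfPattern :
    letterPattern outer inner (tableauOfPattern outer inner x) = x := by
  funext i l
  induction i with
  | zero => rw [letterPattern_zero, h.pattern.zero]
  | succ i ih =>
    rcases lt_or_ge i d with hi | hi
    · have hk := h.columnBound_letterPattern_tableauOfPattern ⟨i, hi⟩ l
      have hk' := h.columnBound_letterPattern_tableauOfPattern ⟨i, hi⟩ (l + 1)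
      rw [columnBound_succ, columnBound_succ, hk, ih] at hk'
      linarith
    · rw [h.pattern.top (i + 1) (Nat.le_succ_of_le hi), ← h.pattern.top i hi, ← ih, letterPattern,
        letterPattern, initialRows_of_le _ _ _ hi, initialRows_of_le _ _ _ (Nat.le_succ_of_le hi)]

theorem isLRTableau_tableauOfPattern :
    IsLRTableau outer inner type (tableauOfPattern outer inner x) where
  ssyt := h.isSkewSSYT_tableauOfPattern
  content i := by
    rw [← initialRows_of_le _ _ _ le_rfl, ← letterPattern, h.letterPattern_tableauOfPattern,
      h.pattern.top d le_rfl, extendZero_val]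
  lattice := h.isSkewSSYT_tableauOfPattern.isLatticeWord_iff.2 fun l _ i _ => by
    rw [h.letterPattern_tableauOfPattern]
    exact h.pattern.succ_le i l

end IsLRPattern

theorem lrNumber_eq_card_lrPatterns (hi : IsPartition inner) (ht : IsPartition type)
    (ho : Antitone outer) :
    lrNumber inner type outer =
      Nat.card {x // IsLRPattern d (extendZero inner) (extendZero type) (extendZero outer) x} := by
  rw [lrNumber]
  split_ifs with h
  · exact Nat.card_congr
      { toFun := fun T => ⟨_, T.2.isLRPattern_letterPattern ho hi.1 ht h.2.2.2⟩
        invFun := fun x => ⟨_, x.2.isLRTableau_tableauOfPattern⟩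
        left_inv := fun T =>
          have hx := T.2.isLRPattern_letterPattern ho hi.1 ht h.2.2.2
          Subtype.ext (hx.isSkewSSYT_tableauOfPattern.eq_of_letterPattern_eq T.2.ssyt
            hx.letterPattern_tableauOfPattern)
        right_inv := fun x => Subtype.ext x.2.letterPattern_tableauOfPattern }
  · refine (Nat.card_eq_zero.2 (Or.inl ⟨fun x => h ?_⟩)).symm
    have hio := x.2.inner_le_outer
    exact ⟨⟨ho, fun i => (hi.2 i).trans (hio i)⟩, hi, ht, hio⟩

end Tableaux

namespace IsPartition

variable {d : ℕ} {α β γ : Fin d → ℤ}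

theorem rect_sub_revTuple (hβ : IsPartition β) {k : ℕ} (hk : β ≤ rect d k) :
    IsPartition (rect d k - revTuple β) :=
  ⟨fun _ _ hij => sub_le_sub_left (hβ.1 (Fin.rev_le_rev.2 hij)) _,
    fun i => sub_nonneg.2 (hk (Fin.rev i))⟩

theorem sub_rect (hγ : IsPartition γ) {m : ℕ} (hm : rect d m ≤ γ) : IsPartition (γ - rect d m) :=
  ⟨fun _ _ hij => sub_le_sub_right (hγ.1 hij) _, fun i => sub_nonneg.2 (hm i)⟩

theorem antitone_add_rect_sub_rect (hα : IsPartition α) (k m : ℕ) :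
    Antitone (α + rect d k - rect d m) := fun _ _ hij =>
  sub_le_sub_right (add_le_add_left (hα.1 hij) _) _

end IsPartition

theorem extendZero_rect_sub_revTuple {d : ℕ} (β : Fin d → ℤ) (k : ℕ) {r : ℕ} (hr : r < d) :
    extendZero (rect d k - revTuple β) r = k - extendZero β (d - 1 - r) := by
  rw [extendZero_val _ ⟨r, hr⟩, Nat.sub_sub, Nat.add_comm, ← Fin.val_rev ⟨r, hr⟩, extendZero_val]
  rfl

theorem mainTheorem7 (d : ℕ) (α β γ : Fin d → ℤ)
    (hα : IsPartition α) (hβ : IsPartition β) (hγ : IsPartition γ)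
    (k m : ℕ) (hk : β ≤ rect d k) (hm : rect d m ≤ γ) :
    lrNumber α β γ =
      lrNumber (rect d k - revTuple β) (γ - rect d m) (α + rect d k - rect d m) := by
  have hinner := hβ.rect_sub_revTuple hk
  have htype := hγ.sub_rect hm
  have houter := hα.antitone_add_rect_sub_rect k m
  rw [lrNumber_eq_card_lrPatterns hα hβ hγ.1, lrNumber_eq_card_lrPatterns hinner htype houter,
    card_lrPatterns_comm hα.antitone_extendZero (fun _ => extendZero_of_le α)
      hβ.antitone_extendZero (fun _ => extendZero_of_le β)
      (hγ.antitone_extendZero.comp_monotone Fin.val_strictMono.monotone),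
    card_lrPatterns_eq_card_hives hα.antitone_extendZero (fun _ => extendZero_of_le α),
    card_lrPatterns_eq_card_hives htype.antitone_extendZero (fun _ => extendZero_of_le _)]
  refine card_hives_reflect (m := m) (fun r hr => extendZero_rect_sub_revTuple β k hr)
    (fun r hr => ?_) (fun r hr => ?_)
  · rw [extendZero_val _ ⟨r, hr⟩, extendZero_val γ ⟨r, hr⟩]
    rfl
  · rw [extendZero_val _ ⟨r, hr⟩, extendZero_val α ⟨r, hr⟩]
    rfl
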